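/- Let $n\ge 1$. A \emph{circled composition} of $n$ is a composition of $n$ (a finite sequence of positive integers with sum $n$) in which some of the parts equal to $1$ are circled, the first and the last part being circled; write $\mathring{1}$ for a circled $1$, and $\mathring{1}^k$ for $k$ consecutive circled $1$s. A circled composition $X$ \emph{dominates} a circled composition $Y$ if $Y$ can be obtained from $X$ by selecting a subsequence of $X$, then replacing every uncircled number $k$ in it by some number in $\{1,\dots,k\}$, and then, if the first or the last term is an uncircled number $k$, replacing that term by $\mathring{1}^k$. Circled compositions $X$ and $Y$ are \emph{Wilf equivalent} if for every $N\ge 1$ the number of circled compositions of $N$ that dominate $X$ equals the number of those that dominate $Y$. A circular permutation $[\sigma]$ of $\{1,\dots,n\}$ is the class of a permutation $\sigma=\sigma_1\cdots\sigma_n$ under rotation; it \emph{contains} $[\pi]$ if some rotation of $\sigma$ has a subsequence that is order isomorphic to $\pi$, and \emph{avoids} $[\pi]$ otherwise. Two sets of circular permutations (patterns) are \emph{Wilf equivalent} if for every $N\ge1$ the same number of circular permutations of $\{1,\dots,N\}$ avoid all patterns of the first set as avoid all patterns of the second. To a circled composition $X$ of $n$ with parts $p_1,\dots,p_r$ assign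 the circular permutation $[\sigma(X)]$ as follows: cut $1,2,\dots,n$ into consecutive intervals $I_1,\dots,I_r$ with $|I_i|=p_i$; write the intervals of the uncircled parts in the order of decreasing index $i$, each one increasingly, and after them the numbers of the circled parts in increasing order. **Theorem.** Every circled composition of $n$ is Wilf equivalent to a circled composition of $n$ of one of the following forms: 1. $\mathring{1}^n$; 2. $\mathring{1}^{k_0}\ a_1\ a_2\ \cdots\ a_k\ \mathring{1}^{k_1}\ a_{k+1}\ \mathring{1}^{k_2}$, where $k,k_1,k_2\ge1$, the $a_i$ are uncircled, $k_0\ge k_2$, $a_1\ge a_2\ge\cdots\ge a_{k+1}$, and none of $a_1,\dots,a_{k+1},k_0,k_2$ equals $2$; 3. $\mathring{1}^{k_0}\ a_1\ a_2\ \cdots\ a_k\ \mathring{1}^{k_2}$, where $k,k_2\ge1$, the $a_i$ are uncircled, $k_0\ge k_2$, $k_0,k_2\ne2$, $a_1\ge a_2\ge\cdots\ge a_k$, and, if $k\ge2$, none of $a_1,\dots,a_k$ equals $2$. Consequently, for every circular permutation $[\sigma]$ of $\{1,\dots,n\}$ that avoids $[1324]$ there is a circled composition $Y$ of $n$ of one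 of these forms such that $[\sigma(Y)]$ avoids $[1324]$ and the pairs $\{[1324],[\sigma]\}$ and $\{[1324],[\sigma(Y)]\}$ are Wilf equivalent. -/

import Mathlib

namespace CircularPattern

/-! ### Circular permutations and pattern avoidance -/

/-- The lists `s` and `p` of numbers are order isomorphic. -/
def OrderIsomorphic (s p : List ℕ) : Prop :=
  ∃ h : s.length = p.length, ∀ i j : Fin s.length,
    s.get i < s.get j ↔ p.get (i.cast h) < p.get (j.cast h)

/-- Linear containment: some subsequence of `l` is order isomorphic to `p`. -/
def LinearContains (l p : List ℕ) : Prop :=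
  ∃ s : List ℕ, s.Sublist l ∧ OrderIsomorphic s p

/-- The circular permutations of `{1, …, n}`, that is, the permutations of `1, …, n` in one-line
notation, taken up to rotation. -/
def circularPerms (n : ℕ) : Set (Cycle ℕ) :=
  {c | ∃ l : List ℕ, l.Perm (List.range' 1 n) ∧ (l : Cycle ℕ) = c}

/-- Circular containment: some rotation of `c` contains a rotation of `d` linearly. -/
def CircularContains (c d : Cycle ℕ) : Prop :=
  ∃ l p : List ℕ, (l : Cycle ℕ) = c ∧ (p : Cycle ℕ) = d ∧ LinearContains l p

/-- The circular permutations of `{1, …, n}` that avoid every pattern in `P`. -/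
def avoiders (n : ℕ) (P : Set (Cycle ℕ)) : Set (Cycle ℕ) :=
  {c | c ∈ circularPerms n ∧ ∀ d ∈ P, ¬ CircularContains c d}

/-- Circular Wilf equivalence of two sets of patterns. -/
def PatternWilfEquiv (P Q : Set (Cycle ℕ)) : Prop :=
  ∀ n : ℕ, 1 ≤ n → (avoiders n P).ncard = (avoiders n Q).ncard

/-- The circular permutation `[1324]`. -/
def c1324 : Cycle ℕ := ([1, 3, 2, 4] : List ℕ)

/-! ### Circled compositions -/

/-- A part of a circled composition: a circled `1`, or an uncircled number. -/
inductive Part where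
  | circ : Part
  | plain (k : ℕ) : Part

/-- The value of a part. -/
def Part.size : Part → ℕ
  | .circ => 1
  | .plain k => k

/-- A circled composition of `n`: a sequence of positive parts with sum `n`, some of the parts equal
to `1` being circled, such that the first part and the last part are circled. -/
structure CircledComposition (n : ℕ) where
  parts : List Part
  plain_pos : ∀ k : ℕ, Part.plain k ∈ parts → 1 ≤ k
  sum_size : (parts.map Part.size).sum = n
  head_circ : parts.head? = some Part.circ
  last_circ : parts.getLast? = some Part.circ

/-- `Shrink p q`: the part `q` is `p` itself if `p` is circled, and an uncircled number in
`{1, …, k}` if `p` is the uncircled number `k`. -/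
inductive Shrink : Part → Part → Prop
  | circ : Shrink Part.circ Part.circ
  | plain (j k : ℕ) (hj : 1 ≤ j) (hjk : j ≤ k) : Shrink (Part.plain k) (Part.plain j)

/-- If the first term is an uncircled number `k`, replace it with `k` circled `1`s. -/
def circleFirst : List Part → List Part
  | Part.plain k :: l => List.replicate k Part.circ ++ l
  | l => l

/-- If the last term is an uncircled number `k`, replace it with `k` circled `1`s. -/
def circleLast (l : List Part) : List Part :=
  (circleFirst l.reverse).reverse

/-- `X` dominates `Y`: select a subsequence `s` of `X`, replace every uncircled number `k` in it by
some number in `{1, …, k}` to get `t`, and replace the first and the last term of `t`, if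
uncircled, by circled `1`s. -/
def Dominates {m n : ℕ} (X : CircledComposition m) (Y : CircledComposition n) : Prop :=
  ∃ s t : List Part, s.Sublist X.parts ∧ List.Forall₂ Shrink s t ∧
    Y.parts = circleLast (circleFirst t)

/-- Wilf equivalence of circled compositions: for every `N ≥ 1` they are dominated by the same number
of circled compositions of `N`. -/
def WilfEquiv {m n : ℕ} (X : CircledComposition m) (Y : CircledComposition n) : Prop :=
  ∀ N : ℕ, 1 ≤ N →
    Nat.card {Z : CircledComposition N // Dominates Z X} =
      Nat.card {Z : CircledComposition N // Dominates Z Y}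

/-! ### The circular permutation of a circled composition -/

/-- The parts of the composition stand for consecutive intervals of numbers, beginning at `s`; the
intervals of the uncircled parts are written in increasing runs, the last interval first. -/
def uncircledWord : List Part → ℕ → List ℕ
  | [], _ => []
  | Part.circ :: l, s => uncircledWord l (s + 1)
  | Part.plain k :: l, s => uncircledWord l (s + k) ++ List.range' s k

/-- The numbers that correspond to circled parts, in increasing order. -/
def circledWord : List Part → ℕ → List ℕ
  | [], _ => []
  | Part.circ :: l, s => s :: circledWord l (s + 1)
  | Part.plain k :: l, s => circledWord l (s + k)

/-- The circular permutation `[σ(X)]` that corresponds to the circled composition `X`. -/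
def CircledComposition.toCircularPerm {n : ℕ} (X : CircledComposition n) : Cycle ℕ :=
  (uncircledWord X.parts 1 ++ circledWord X.parts 1 : List ℕ)

/-! ### The normal forms -/

/-- The sequence consisting of `k` circled `1`s. -/
def circs (k : ℕ) : List Part := List.replicate k Part.circ

/-- All parts are circled. -/
def CircledComposition.IsAllCircled {n : ℕ} (X : CircledComposition n) : Prop :=
  X.parts = circs n

/-- `k₀` circled `1`s, then uncircled numbers `a₁ ≥ ⋯ ≥ a_k` (`k ≥ 1`), then `k₁ ≥ 1` circled `1`s,
then an uncircled number `b ≤ a_k`, then `k₂` circled `1`s, where `k₀ ≥ k₂ ≥ 1`, and none of the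
uncircled numbers, `k₀`, `k₂` is `2`. -/
def CircledComposition.IsSplitForm {n : ℕ} (X : CircledComposition n) : Prop :=
  ∃ (k₀ k₁ k₂ : ℕ) (a : List ℕ) (b : ℕ),
    X.parts = circs k₀ ++ a.map Part.plain ++ circs k₁ ++ [Part.plain b] ++ circs k₂ ∧
    a ≠ [] ∧ 1 ≤ k₁ ∧ 1 ≤ k₂ ∧ k₂ ≤ k₀ ∧ (a ++ [b]).Pairwise (fun x y => x ≥ y) ∧
    2 ∉ a ++ [b] ∧ k₀ ≠ 2 ∧ k₂ ≠ 2

/-- `k₀` circled `1`s, then uncircled numbers `a₁ ≥ ⋯ ≥ a_k` (`k ≥ 1`), then `k₂` circled `1`s,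
where `k₀ ≥ k₂ ≥ 1`, neither `k₀` nor `k₂` is `2`, and no `aᵢ` is `2` unless `k = 1`. -/
def CircledComposition.IsBlockForm {n : ℕ} (X : CircledComposition n) : Prop :=
  ∃ (k₀ k₂ : ℕ) (a : List ℕ),
    X.parts = circs k₀ ++ a.map Part.plain ++ circs k₂ ∧
    a ≠ [] ∧ 1 ≤ k₂ ∧ k₂ ≤ k₀ ∧ a.Pairwise (fun x y => x ≥ y) ∧
    k₀ ≠ 2 ∧ k₂ ≠ 2 ∧ (2 ≤ a.length → 2 ∉ a)

/-- One of the three normal forms. -/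
def CircledComposition.IsNormalForm {n : ℕ} (X : CircledComposition n) : Prop :=
  X.IsAllCircled ∨ X.IsSplitForm ∨ X.IsBlockForm

end CircularPattern

namespace CircularPattern

/-! The Wilf class of a circled composition can be read off a generating function that factors over
its parts. Write it as `circs k₀ ++ M ++ circs k₂`, where `M` begins and ends with an uncircled part
(otherwise all parts are circled, which is already a normal form). A dominating composition is
scanned from the left: take the shortest segment that serves the left end, then for each letter of
`M` the shortest segment ending in a letter that can shrink to it; what remains serves the right
end. This greedy factorization is unique, so `gf_dominating` gives the product of `gfEnd k₀`, one
factor `gfPart p` for each `p` in `M`, `gfEnd k₂`, and a constant series.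

Hence only the multiset of letters of `M` and the unordered pair `k₀, k₂` matter: the uncircled
parts may be sorted, the circled `1`s of `M` gathered before its last part, and the ends exchanged.
Two identities remove the `2`s. By `gfPart_two_eq` an uncircled `2` is worth an uncircled `1` and a
circled `1`; this can be realized if there are two uncircled parts to put the circled `1` between.
By `gfEnd_one` and `gfEnd_two` an end of two circled `1`s is worth an end of one circled `1` next to
an uncircled `1`. `exists_data` extracts the product from a composition, and `exists_normalForm`
realizes a normalized product.

The statement on patterns follows because `toCircularPerm` is a bijection from the circled
compositions of `N` onto the `[1324]`-avoiders (`IsCircled.eq_of_word_isRotated`,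
`exists_toCircularPerm_eq`, `not_circularContains_c1324`) that turns domination into containment
(`circularContains_iff_dominates`). Avoiders and dominating compositions are then complementary
counts (`ncard_avoiders`). -/

/-! ### Generating functions of sets of words -/

/-- All uncircled parts of the word are positive. -/
def Positive (w : List Part) : Prop := ∀ k : ℕ, Part.plain k ∈ w → 1 ≤ k

/-- The sum of the parts of a word. -/
def totalSize (w : List Part) : ℕ := (w.map Part.size).sum

@[simp] theorem totalSize_nil : totalSize [] = 0 := rfl

@[simp] theorem totalSize_cons (p : Part) (w : List Part) :
    totalSize (p :: w) = p.size + totalSize w := by simp [totalSize]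

@[simp] theorem totalSize_append (u v : List Part) :
    totalSize (u ++ v) = totalSize u + totalSize v := by simp [totalSize]

@[simp] theorem totalSize_reverse (w : List Part) : totalSize w.reverse = totalSize w := by
  simp [totalSize]

theorem positive_append {u v : List Part} : Positive (u ++ v) ↔ Positive u ∧ Positive v := by
  simp only [Positive, List.mem_append, or_imp, forall_and]

theorem positive_cons {p : Part} {w : List Part} :
    Positive (p :: w) ↔ 1 ≤ p.size ∧ Positive w := by
  cases p <;> simp [Positive, Part.size]

theorem positive_reverse {w : List Part} : Positive w.reverse ↔ Positive w := by
  simp [Positive]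

theorem positive_nil : Positive [] := by simp [Positive]

theorem length_le_totalSize {w : List Part} (h : Positive w) : w.length ≤ totalSize w := by
  induction w with
  | nil => simp
  | cons p w ih =>
    rw [positive_cons] at h
    have := ih h.2
    simp only [List.length_cons, totalSize_cons]
    omega

/-- The positive words of size `n` in the set `L`. -/
def words (L : Set (List Part)) (n : ℕ) : Set (List Part) :=
  {w | w ∈ L ∧ Positive w ∧ totalSize w = n}

theorem words_finite (L : Set (List Part)) (n : ℕ) : (words L n).Finite := by
  have hfin : Finite (Fin (n + 2)) := inferInstance
  -- The value `n + 1` encodes the circled `1`; every uncircled part of a word of size `n` is at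
  -- most `n`.
  let dec : Fin (n + 2) → Part := fun i => if (i : ℕ) = n + 1 then .circ else .plain i
  refine ((List.finite_length_le (Fin (n + 2)) n).image (List.map dec)).subset ?_
  rintro w ⟨-, hw, rfl⟩
  have key : ∀ p ∈ w, ∃ i : Fin (totalSize w + 2), dec i = p := by
    intro p hp
    have hle : p.size ≤ totalSize w :=
      List.single_le_sum (by simp) _ (List.mem_map_of_mem hp)
    cases p with
    | circ => exact ⟨⟨totalSize w + 1, by omega⟩, by simp [dec]⟩
    | plain k =>
      simp only [Part.size] at hle
      exact ⟨⟨k, by omega⟩, by simp [dec]; omega⟩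
  have : ∃ l : List (Fin (totalSize w + 2)), l.map dec = w := by
    have hr : w ∈ Set.range (List.map dec) := by
      rw [Set.range_list_map]
      intro p hp
      obtain ⟨i, hi⟩ := key p hp
      exact ⟨i, hi⟩
    exact hr
  obtain ⟨l, hl⟩ := this
  refine ⟨l, ?_, hl⟩
  have := length_le_totalSize hw
  rw [← hl, List.length_map] at this
  simpa [hl] using this

/-- The generating function of the positive words in `L` by size. -/
noncomputable def gf (L : Set (List Part)) : PowerSeries ℤ :=
  PowerSeries.mk fun n => ((words L n).ncard : ℤ)

theorem gf_union {S T : Set (List Part)} (h : Disjoint S T) : gf (S ∪ T) = gf S + gf T := by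
  ext n
  simp only [gf, PowerSeries.coeff_mk, map_add]
  have : words (S ∪ T) n = words S n ∪ words T n := by
    ext w; simp only [words, Set.mem_union, Set.mem_ofPred_eq]; tauto
  rw [this, Set.ncard_union_eq _ (words_finite _ _) (words_finite _ _)]
  · simp
  · exact h.mono (fun w hw => hw.1) (fun w hw => hw.1)

theorem gf_image {f : List Part → List Part} (hf : Function.Injective f) (d : ℕ)
    (hs : ∀ w, totalSize (f w) = totalSize w + d) (hp : ∀ w, Positive (f w) ↔ Positive w)
    (L : Set (List Part)) : gf (f '' L) = PowerSeries.X ^ d * gf L := by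
  ext n
  rw [PowerSeries.coeff_X_pow_mul']
  simp only [gf, PowerSeries.coeff_mk]
  split_ifs with h
  · have : words (f '' L) n = f '' words L (n - d) := by
      ext w
      constructor
      · rintro ⟨⟨u, hu, rfl⟩, h1, h2⟩
        rw [hs] at h2
        exact ⟨u, ⟨hu, (hp u).1 h1, by omega⟩, rfl⟩
      · rintro ⟨u, ⟨hu, h1, h2⟩, rfl⟩
        exact ⟨⟨u, hu, rfl⟩, (hp u).2 h1, by rw [hs]; omega⟩
    rw [this, Set.ncard_image_of_injective _ hf]
  · have : words (f '' L) n = ∅ := by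
      ext w
      simp only [Set.mem_empty_iff_false, iff_false]
      rintro ⟨⟨u, hu, rfl⟩, h1, h2⟩
      rw [hs] at h2
      omega
    simp [this]

/-- The set of concatenations of a word in `S` and a word in `T`. -/
def concat (S T : Set (List Part)) : Set (List Part) := Set.image2 (· ++ ·) S T

theorem mem_concat {S T : Set (List Part)} {w : List Part} :
    w ∈ concat S T ↔ ∃ u v, u ∈ S ∧ v ∈ T ∧ u ++ v = w := by
  simp only [concat, Set.mem_image2]
  grind

/-- No word in the set is a proper prefix of another one. -/
def PrefixFree (S : Set (List Part)) : Prop := ∀ u ∈ S, ∀ v ∈ S, u <+: v → u = v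

/-- Factorizations are unique: of two prefixes of the same word one is a prefix of the other, so
within `S` they agree. -/
theorem gf_concat {S T : Set (List Part)} (hS : PrefixFree S) :
    gf (concat S T) = gf S * gf T := by
  ext n
  rw [PowerSeries.coeff_mul]
  simp only [gf, PowerSeries.coeff_mk]
  let F : Set (List Part) → ℕ → Finset (List Part) := fun L n => (words_finite L n).toFinset
  have hF : ∀ L n, (words L n).ncard = (F L n).card := fun L n =>
    Set.ncard_eq_toFinset_card _ _
  simp only [hF]
  norm_cast
  simp only [← Finset.card_product]
  rw [← Finset.card_sigma]
  symm
  refine Finset.card_bij (fun a _ => a.2.1 ++ a.2.2) ?_ ?_ ?_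
  · rintro ⟨⟨i, j⟩, u, v⟩ h
    simp only [Finset.mem_sigma, Finset.mem_product, F,
      Set.Finite.mem_toFinset] at h ⊢
    obtain ⟨h0, ⟨hu, hu1, rfl⟩, hv, hv1, rfl⟩ := h
    obtain rfl := Finset.HasAntidiagonal.mem_antidiagonal.1 h0
    exact ⟨mem_concat.2 ⟨u, v, hu, hv, rfl⟩, positive_append.2 ⟨hu1, hv1⟩, by simp⟩
  · rintro ⟨⟨i, j⟩, u, v⟩ h ⟨⟨i', j'⟩, u', v'⟩ h' heq
    simp only [Finset.mem_sigma, Finset.mem_product, F,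
      Set.Finite.mem_toFinset] at h h' heq
    obtain ⟨-, ⟨hu, hu1, rfl⟩, hv, hv1, rfl⟩ := h
    obtain ⟨-, ⟨hu', hu1', rfl⟩, hv', hv1', rfl⟩ := h'
    have huu : u = u' := by
      rcases List.prefix_or_prefix_of_prefix (List.prefix_append u v)
        (heq ▸ List.prefix_append u' v') with h | h
      · exact hS u hu u' hu' h
      · exact (hS u' hu' u hu h).symm
    subst huu
    have hvv := List.append_cancel_left heq
    subst hvv
    rfl
  · intro w hw
    simp only [F, Set.Finite.mem_toFinset] at hw
    obtain ⟨h, h1, h2⟩ := hw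
    obtain ⟨u, v, hu, hv, rfl⟩ := mem_concat.1 h
    rw [positive_append] at h1
    refine ⟨⟨⟨totalSize u, totalSize v⟩, u, v⟩, ?_, rfl⟩
    simp only [Finset.mem_sigma, Finset.mem_product, F,
      Set.Finite.mem_toFinset]
    exact ⟨Finset.HasAntidiagonal.mem_antidiagonal.2 (by simpa using h2), ⟨hu, h1.1, rfl⟩, hv, h1.2, rfl⟩

/-- The words of `S` no proper prefix of which lies in `S`. -/
def minimalWords (S : Set (List Part)) : Set (List Part) :=
  {w | w ∈ S ∧ ∀ u ∈ S, u <+: w → u = w}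

theorem prefixFree_minimalWords (S : Set (List Part)) : PrefixFree (minimalWords S) :=
  fun u hu _ hv h => hv.2 u hu.1 h

theorem exists_minimal_prefix {S : Set (List Part)} {w : List Part} (hw : w ∈ S) :
    ∃ u v, u ∈ minimalWords S ∧ u ++ v = w := by
  induction hn : w.length using Nat.strong_induction_on generalizing w with
  | _ n ih =>
    by_cases h : ∀ u ∈ S, u <+: w → u = w
    · exact ⟨w, [], ⟨hw, h⟩, by simp⟩
    · push Not at h
      obtain ⟨u, hu, ⟨r, rfl⟩, hne⟩ := h
      have : u.length < n := by
        rw [← hn, List.length_append]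
        have : r ≠ [] := by rintro rfl; simp at hne
        have := List.length_pos_iff.2 this
        omega
      obtain ⟨a, b, ha, rfl⟩ := ih _ this hu rfl
      exact ⟨a, b ++ r, ha, by simp⟩

/-- The set is closed under putting a word in front. -/
def LeftClosed (S : Set (List Part)) : Prop := ∀ u : List Part, ∀ v ∈ S, u ++ v ∈ S

/-- When the first factor is cut down to a minimal prefix, `T` absorbs the piece cut off. This makes
an ambiguous concatenation unambiguous. -/
theorem concat_minimalWords (S : Set (List Part)) {T : Set (List Part)} (hT : LeftClosed T) :
    concat (minimalWords S) T = concat S T := by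
  ext w
  simp only [mem_concat]
  constructor
  · rintro ⟨u, v, hu, hv, rfl⟩
    exact ⟨u, v, hu.1, hv, rfl⟩
  · rintro ⟨u, v, hu, hv, rfl⟩
    obtain ⟨a, b, ha, rfl⟩ := exists_minimal_prefix hu
    exact ⟨a, b ++ v, ha, hT _ _ hv, by simp⟩

theorem gf_concat_leftClosed (S : Set (List Part)) {T : Set (List Part)} (hT : LeftClosed T) :
    gf (concat S T) = gf (minimalWords S) * gf T := by
  rw [← concat_minimalWords S hT, gf_concat (prefixFree_minimalWords S)]

theorem gf_eq_minimalWords_mul {S : Set (List Part)} (hS : ∀ u ∈ S, ∀ v, u ++ v ∈ S) :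
    gf S = gf (minimalWords S) * gf Set.univ := by
  rw [← gf_concat_leftClosed S (fun _ _ _ => Set.mem_univ _)]
  congr 1
  ext w
  simp only [mem_concat]
  constructor
  · exact fun h => ⟨w, [], h, Set.mem_univ _, by simp⟩
  · rintro ⟨u, v, hu, -, rfl⟩
    exact hS u hu v

/-! ### Embeddings of words -/

/-- The word `t` arises from a subsequence of `w` by shrinking uncircled parts. -/
def Embeds (t w : List Part) : Prop := ∃ s : List Part, s.Sublist w ∧ List.Forall₂ Shrink s t

theorem embeds_nil (w : List Part) : Embeds [] w := ⟨[], List.nil_sublist _, .nil⟩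

theorem Embeds.mono {t w w' : List Part} (h : Embeds t w) (hw : w.Sublist w') : Embeds t w' := by
  obtain ⟨s, hs, h⟩ := h
  exact ⟨s, hs.trans hw, h⟩

theorem Embeds.append {t t' w w' : List Part} (h : Embeds t w) (h' : Embeds t' w') :
    Embeds (t ++ t') (w ++ w') := by
  obtain ⟨s, hs, h⟩ := h
  obtain ⟨s', hs', h'⟩ := h'
  exact ⟨s ++ s', hs.append hs', List.rel_append h h'⟩

theorem embeds_append_iff {t t' w : List Part} :
    Embeds (t ++ t') w ↔ ∃ u u', u ++ u' = w ∧ Embeds t u ∧ Embeds t' u' := by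
  constructor
  · rintro ⟨s, hs, h⟩
    rw [← List.take_append_drop t.length s, List.append_sublist_iff] at hs
    obtain ⟨r₁, r₂, rfl, h1, h2⟩ := hs
    exact ⟨r₁, r₂, rfl, ⟨_, h1, List.forall₂_take_append _ _ _ h⟩,
      ⟨_, h2, List.forall₂_drop_append _ _ _ h⟩⟩
  · rintro ⟨u, u', rfl, h, h'⟩
    exact h.append h'

theorem embeds_reverse {t w : List Part} : Embeds t.reverse w.reverse ↔ Embeds t w := by
  have key : ∀ {t w : List Part}, Embeds t w → Embeds t.reverse w.reverse := by
    rintro t w ⟨s, hs, h⟩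
    exact ⟨s.reverse, List.reverse_sublist.2 hs, List.forall₂_reverse_iff.2 h⟩
  exact ⟨fun h => by simpa using key h, key⟩

theorem Embeds.length_le {t w : List Part} (h : Embeds t w) : t.length ≤ w.length := by
  obtain ⟨s, hs, h⟩ := h
  rw [← h.length_eq]
  exact hs.length_le

theorem embeds_singleton_iff {q : Part} {w : List Part} :
    Embeds [q] w ↔ ∃ p ∈ w, Shrink p q := by
  constructor
  · rintro ⟨s, hs, h⟩
    obtain ⟨p, _, hp, h', rfl⟩ := List.forall₂_cons_right_iff.1 h
    obtain rfl := List.forall₂_nil_right_iff.1 h'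
    exact ⟨p, List.singleton_sublist.1 hs, hp⟩
  · rintro ⟨p, hp, h⟩
    exact ⟨[p], List.singleton_sublist.2 hp, .cons h .nil⟩

/-- The words in which `t` embeds. -/
def above (t : List Part) : Set (List Part) := {w | Embeds t w}

theorem leftClosed_above (t : List Part) : LeftClosed (above t) :=
  fun u _ hv => Embeds.mono hv (List.sublist_append_right u _)

theorem above_append (t t' : List Part) : above (t ++ t') = concat (above t) (above t') := by
  ext w
  rw [mem_concat]
  simp only [above, Set.mem_ofPred_eq, embeds_append_iff]
  grind

theorem concat_assoc (S T U : Set (List Part)) :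
    concat (concat S T) U = concat S (concat T U) :=
  Set.image2_assoc List.append_assoc

theorem LeftClosed.concat {S T : Set (List Part)} (hS : LeftClosed S) :
    LeftClosed (concat S T) := by
  intro u w hw
  obtain ⟨a, b, ha, hb, rfl⟩ := mem_concat.1 hw
  exact mem_concat.2 ⟨u ++ a, b, hS u a ha, hb, by simp⟩

/-- The generating function of the shortest words that end in a part that can shrink to `p`. -/
noncomputable def gfPart (p : Part) : PowerSeries ℤ := gf (minimalWords (above [p]))

/-- The leftmost embedding of `t` cuts a word into one minimal segment per letter, so the order of
the letters does not affect the series. -/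
theorem gf_concat_above (t : List Part) {T : Set (List Part)} (hT : LeftClosed T) :
    gf (concat (above t) T) = (t.map gfPart).prod * gf T := by
  induction t with
  | nil =>
    have : concat (above []) T = T := by
      ext w
      rw [mem_concat]
      constructor
      · rintro ⟨u, v, -, hv, rfl⟩
        exact hT u v hv
      · exact fun h => ⟨[], w, embeds_nil _, h, rfl⟩
    simp [this]
  | cons p t ih =>
    have : above (p :: t) = concat (above [p]) (above t) := above_append [p] t
    rw [this, concat_assoc, gf_concat_leftClosed _ (leftClosed_above t).concat, ih]
    simp [gfPart, mul_assoc]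

/-! ### The series of single parts -/

/-- The one-letter words with a letter in `A`. -/
def letters (A : Set Part) : Set (List Part) := (fun p => [p]) '' A

theorem prefixFree_letters (A : Set Part) : PrefixFree (letters A) := by
  rintro _ ⟨p, -, rfl⟩ _ ⟨q, -, rfl⟩ h
  exact h.eq_of_length rfl

theorem mem_minimalWords_above_singleton {p : Part} {w : List Part} :
    w ∈ minimalWords (above [p]) ↔
      ∃ v a, w = v ++ [a] ∧ Shrink a p ∧ ∀ b ∈ v, ¬ Shrink b p := by
  simp only [minimalWords, above, Set.mem_ofPred_eq, embeds_singleton_iff]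
  constructor
  · rintro ⟨⟨a, ha, hap⟩, hmin⟩
    obtain ⟨v, r, rfl⟩ := List.append_of_mem ha
    have h1 := hmin (v ++ [a]) ⟨a, by simp, hap⟩ ⟨r, by simp⟩
    refine ⟨v, a, h1.symm, hap, fun b hb hbp => ?_⟩
    have h2 := hmin v ⟨b, hb, hbp⟩ ⟨_, rfl⟩
    simp at h2
  · rintro ⟨v, a, rfl, hap, hv⟩
    refine ⟨⟨a, by simp, hap⟩, ?_⟩
    rintro u ⟨b, hb, hbp⟩ hu
    rcases List.prefix_concat_iff.1 hu with h | h
    · exact h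
    · exact absurd hbp (hv b (h.subset hb))

/-- Split by the first letter: either it shrinks to `p` and the word ends there, or it does not and
the rest is again a minimal word. -/
theorem gfPart_eq (p : Part) :
    gfPart p = gf (letters {a | Shrink a p}) + gf (letters {a | ¬ Shrink a p}) * gfPart p := by
  conv_rhs => rw [gfPart, ← gf_concat (prefixFree_letters _)]
  rw [← gf_union, gfPart]
  · congr 1
    ext w
    simp only [Set.mem_union, mem_concat, mem_minimalWords_above_singleton, letters, Set.mem_image,
      Set.mem_ofPred_eq]
    constructor
    · rintro ⟨v, a, rfl, ha, hv⟩
      cases v with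
      | nil => exact .inl ⟨a, ha, rfl⟩
      | cons b v =>
        exact .inr ⟨[b], v ++ [a], ⟨b, hv b (by simp), rfl⟩,
          ⟨v, a, rfl, ha, fun c hc => hv c (by simp [hc])⟩, rfl⟩
    · rintro (⟨a, ha, rfl⟩ | ⟨_, _, ⟨b, hb, rfl⟩, ⟨v, a, rfl, ha, hv⟩, rfl⟩)
      · exact ⟨[], a, rfl, ha, by simp⟩
      · exact ⟨b :: v, a, rfl, ha, by simpa using ⟨hb, hv⟩⟩
  · rw [Set.disjoint_left]
    rintro _ ⟨a, ha, rfl⟩ h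
    obtain ⟨_, _, ⟨b, hb, rfl⟩, -, h⟩ := mem_concat.1 h
    simp only [List.cons_append, List.nil_append, List.cons.injEq] at h
    obtain ⟨rfl, -⟩ := h
    exact hb ha

theorem gf_congr {S T : Set (List Part)} (h : ∀ w, Positive w → (w ∈ S ↔ w ∈ T)) :
    gf S = gf T := by
  ext n
  have : words S n = words T n := by
    ext w
    simp only [words, Set.mem_ofPred_eq]
    have := h w
    tauto
  simp [gf, this]

theorem gf_singleton {w : List Part} (h : Positive w) :
    gf {w} = PowerSeries.X ^ totalSize w := by
  ext n
  rw [PowerSeries.coeff_X_pow]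
  simp only [gf, PowerSeries.coeff_mk]
  split_ifs with hn
  · have : words {w} n = {w} := by
      ext u
      simp only [words, Set.mem_ofPred_eq, Set.mem_singleton_iff]
      constructor
      · exact fun h => h.1
      · rintro rfl; exact ⟨rfl, h, hn.symm⟩
    simp [this]
  · have : words {w} n = ∅ := by
      ext u
      simp only [words, Set.mem_ofPred_eq, Set.mem_singleton_iff, Set.mem_empty_iff_false,
        iff_false]
      rintro ⟨rfl, -, rfl⟩
      exact hn rfl
    simp [this]

theorem letters_union (A B : Set Part) : letters (A ∪ B) = letters A ∪ letters B :=
  Set.image_union _ _ _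

theorem disjoint_letters {A B : Set Part} (h : Disjoint A B) :
    Disjoint (letters A) (letters B) :=
  (Set.disjoint_image_iff (fun _ _ h => by simpa using h)).2 h

theorem shrink_circ {a : Part} : Shrink a Part.circ ↔ a = Part.circ := by
  constructor
  · rintro ⟨⟩; rfl
  · rintro rfl; exact .circ

theorem shrink_plain {a : Part} {j : ℕ} (hj : 1 ≤ j) :
    Shrink a (Part.plain j) ↔ ∃ k, j ≤ k ∧ a = Part.plain k := by
  constructor
  · rintro ⟨⟩; exact ⟨_, ‹_›, rfl⟩
  · rintro ⟨k, hk, rfl⟩; exact .plain _ _ hj hk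

/-- The series of the uncircled letters. -/
noncomputable def gfPlain : PowerSeries ℤ := gf (letters {a | Shrink a (Part.plain 1)})

/-- The series of the uncircled letters other than `1`. -/
noncomputable def gfLarge : PowerSeries ℤ := gf (letters {a | Shrink a (Part.plain 2)})

theorem gf_letter_circ : gf (letters {Part.circ}) = PowerSeries.X := by
  simp [letters, gf_singleton (w := [Part.circ]) (by simp [Positive]), Part.size]

theorem gf_letter_one : gf (letters {Part.plain 1}) = PowerSeries.X := by
  simp [letters, gf_singleton (w := [Part.plain 1]) (by simp [Positive]), Part.size]

theorem gfPlain_eq : gfPlain = PowerSeries.X + gfLarge := by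
  rw [gfPlain, gfLarge, ← gf_letter_one, ← gf_union, ← letters_union]
  · congr 2
    ext a
    simp only [Set.mem_ofPred_eq, Set.mem_union, Set.mem_singleton_iff, shrink_plain le_rfl,
      shrink_plain one_le_two]
    constructor
    · rintro ⟨k, hk, rfl⟩
      rcases hk.eq_or_lt with rfl | h
      · exact .inl rfl
      · exact .inr ⟨k, h, rfl⟩
    · rintro (rfl | ⟨k, hk, rfl⟩)
      · exact ⟨1, le_rfl, rfl⟩
      · exact ⟨k, by omega, rfl⟩
  · apply disjoint_letters
    rw [Set.disjoint_left]
    rintro _ rfl h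
    simp [shrink_plain one_le_two] at h

/-- Add one to an uncircled letter. -/
def Part.succ : Part → Part
  | .circ => .circ
  | .plain k => .plain (k + 1)

/-- Adding one to the letter is the bijection. With `gfPlain_eq` this says that `gfPlain` is `x / (1
- x)`. -/
theorem gfLarge_eq : gfLarge = PowerSeries.X * gfPlain := by
  ext n
  rw [mul_comm]
  have hinj : Function.Injective (List.map Part.succ) := by
    apply List.map_injective_iff.2
    rintro (_ | a) (_ | b) h <;> simp_all [Part.succ]
  cases n with
  | zero =>
    have : words (letters {a | Shrink a (Part.plain 2)}) 0 = ∅ := by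
      ext w
      simp only [Set.mem_empty_iff_false, iff_false]
      rintro ⟨⟨a, ha, rfl⟩, h1, h2⟩
      rw [positive_cons] at h1
      simp at h2
      omega
    simp [gfLarge, gf, this]
  | succ n =>
    rw [PowerSeries.coeff_succ_mul_X]
    simp only [gfLarge, gfPlain, gf, PowerSeries.coeff_mk]
    rw [← Set.ncard_image_of_injective (words (letters {a | Shrink a (Part.plain 1)}) n) hinj]
    congr 2
    ext w
    constructor
    · rintro ⟨⟨a, ha, rfl⟩, h1, h2⟩
      obtain ⟨k, hk, rfl⟩ := (shrink_plain one_le_two).1 ha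
      refine ⟨[.plain (k - 1)], ⟨⟨_, (shrink_plain le_rfl).2 ⟨k - 1, by omega, rfl⟩, rfl⟩, ?_, ?_⟩, ?_⟩
      · simp [positive_cons, positive_nil, Part.size]; omega
      · simp [Part.size] at h2 ⊢; omega
      · simp [Part.succ]; omega
    · rintro ⟨_, ⟨⟨a, ha, rfl⟩, h1, h2⟩, rfl⟩
      obtain ⟨k, hk, rfl⟩ := (shrink_plain le_rfl).1 ha
      refine ⟨⟨_, (shrink_plain one_le_two).2 ⟨k + 1, by omega, rfl⟩, rfl⟩, ?_, ?_⟩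
      · simp [positive_cons, positive_nil, Part.size, Part.succ]
      · simp [Part.size, Part.succ] at h2 ⊢; omega

theorem gf_letters_add_of_positive {A B C : Set Part} (hd : Disjoint A B)
    (h : ∀ a : Part, 1 ≤ a.size → (a ∈ C ↔ a ∈ A ∨ a ∈ B)) :
    gf (letters C) = gf (letters A) + gf (letters B) := by
  rw [← gf_union (disjoint_letters hd), ← letters_union]
  apply gf_congr
  intro w hw
  simp only [letters, Set.mem_image, Set.mem_union]
  constructor
  · rintro ⟨a, ha, rfl⟩
    exact ⟨a, (h a (positive_cons.1 hw).1).1 ha, rfl⟩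
  · rintro ⟨a, ha, rfl⟩
    exact ⟨a, (h a (positive_cons.1 hw).1).2 ha, rfl⟩

theorem gfPart_circ : gfPart .circ = PowerSeries.X + gfPlain * gfPart .circ := by
  conv_lhs => rw [gfPart_eq]
  congr 2
  · rw [← gf_letter_circ]
    congr 2
    ext a
    simp [shrink_circ]
  · apply gf_congr
    intro w hw
    simp only [letters, Set.mem_image]
    apply exists_congr
    rintro (_ | k)
    · simp [shrink_circ, shrink_plain]
    · simp only [Set.mem_ofPred_eq, shrink_circ, reduceCtorEq, not_false_eq_true, true_and,
        shrink_plain le_rfl, Part.plain.injEq]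
      constructor
      · rintro rfl
        exact ⟨⟨k, hw k (by simp), rfl⟩, rfl⟩
      · exact fun h => h.2

theorem gfPart_one : gfPart (.plain 1) = gfPlain + PowerSeries.X * gfPart (.plain 1) := by
  conv_lhs => rw [gfPart_eq]
  congr 2
  rw [← gf_letter_circ]
  apply gf_congr
  intro w hw
  simp only [letters, Set.mem_image]
  apply exists_congr
  rintro (_ | k)
  · simp [shrink_plain]
  · simp only [Set.mem_ofPred_eq, Set.mem_singleton_iff, reduceCtorEq, false_and,
      shrink_plain le_rfl, Part.plain.injEq, iff_false]
    rintro ⟨h, rfl⟩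
    exact h ⟨k, hw k (by simp), rfl⟩

theorem gfPart_two :
    gfPart (.plain 2) = gfLarge + (PowerSeries.X + PowerSeries.X) * gfPart (.plain 2) := by
  conv_lhs => rw [gfPart_eq]
  congr 2
  have hd : Disjoint ({Part.circ} : Set Part) {Part.plain 1} := by simp
  rw [gf_letters_add_of_positive hd, gf_letter_circ, gf_letter_one]
  rintro (_ | k) hk
  · simp [shrink_plain]
  · simp only [Part.size] at hk
    simp only [Set.mem_ofPred_eq, Set.mem_singleton_iff, reduceCtorEq, false_or,
      shrink_plain one_le_two, Part.plain.injEq]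
    constructor
    · intro h
      by_contra h'
      exact h ⟨k, by omega, rfl⟩
    · rintro rfl ⟨k, hk, rfl⟩
      omega

/-- Solving the linear equations gives `x(1 - x)/(1 - 2x)` for a circled `1`, `x/(1 - x)²` for an
uncircled `1`, and `x²/((1 - x)(1 - 2x))`, their product, for an uncircled `2`. -/
theorem gfPart_two_eq : gfPart (.plain 2) = gfPart .circ * gfPart (.plain 1) := by
  have h1 := gfPart_circ
  have h2 := gfPart_one
  have h3 := gfPart_two
  have h4 := gfPlain_eq
  have h5 := gfLarge_eq
  have hne : (1 - PowerSeries.X - PowerSeries.X : PowerSeries ℤ) ≠ 0 := by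
    intro h
    have := congrArg (PowerSeries.coeff 0) h
    simp at this
  apply mul_left_cancel₀ hne
  set x : PowerSeries ℤ := PowerSeries.X
  linear_combination h3 + h5 - (1 - x) * gfPart (.plain 1) * h1 - x * h2
    - (gfPart .circ * gfPart (.plain 1)) * (h5 + h4)

/-! ### The generating function of the dominating circled compositions -/

theorem circleFirst_append {t : List Part} (ht : t ≠ []) (u : List Part) :
    circleFirst (t ++ u) = circleFirst t ++ u := by
  rcases t with _ | ⟨_ | k, t⟩ <;> simp_all [circleFirst]

theorem circleLast_append {t : List Part} (ht : t ≠ []) (u : List Part) :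
    circleLast (u ++ t) = u ++ circleLast t := by
  simp [circleLast, circleFirst_append (t := t.reverse) (by simpa using ht)]

theorem reverse_circs (k : ℕ) : (circs k).reverse = circs k := by simp [circs]

theorem circs_add (j k : ℕ) : circs (j + k) = circs j ++ circs k := by
  simp [circs, List.replicate_append_replicate]

theorem circs_ne_nil {k : ℕ} (hk : 1 ≤ k) : circs k ≠ [] := by
  simp [circs]; omega

@[simp] theorem totalSize_circs (k : ℕ) : totalSize (circs k) = k := by
  simp [totalSize, circs, Part.size]

theorem positive_circs (k : ℕ) : Positive (circs k) := by
  simp [Positive, circs]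

/-- The circled `1`s made from the first term all precede the first uncircled letter of the result,
so the word is unchanged from that letter on. -/
theorem circleFirst_eq_append {r : List Part} {k a : ℕ} {B : List Part}
    (h : circleFirst r = circs k ++ Part.plain a :: B) :
    ∃ t, r = t ++ Part.plain a :: B ∧ circleFirst t = circs k := by
  rcases r with _ | ⟨_ | j, l⟩
  · simp [circleFirst] at h
  · refine ⟨circs k, by simpa [circleFirst] using h, ?_⟩
    cases k <;> simp [circs, List.replicate_succ, circleFirst]
  · simp only [circleFirst] at h
    change circs j ++ l = _ at h
    rcases le_or_gt j k with hjk | hjk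
    · obtain ⟨d, rfl⟩ := Nat.exists_eq_add_of_le hjk
      rw [circs_add, List.append_assoc] at h
      have h := List.append_cancel_left h
      exact ⟨Part.plain j :: circs d, by simp [h], by simp [circleFirst, circs]⟩
    · obtain ⟨d, rfl⟩ := Nat.exists_eq_add_of_lt hjk
      rw [add_assoc, circs_add, List.append_assoc] at h
      have h := List.append_cancel_left h
      simp [circs, List.replicate_succ] at h

/-- The uncircled first and last letters of `M` act as barriers: each end is circled independently,
and `M` itself must already occur in `t`. -/
theorem circleLast_circleFirst_eq_iff {k₀ k₂ a b : ℕ} (h₀ : 1 ≤ k₀) (h₂ : 1 ≤ k₂)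
    {M A B : List Part} (hA : M = Part.plain a :: A) (hB : M = B ++ [Part.plain b])
    (t : List Part) :
    circs k₀ ++ M ++ circs k₂ = circleLast (circleFirst t) ↔
      ∃ t₀ t₂, t = t₀ ++ M ++ t₂ ∧ circleFirst t₀ = circs k₀ ∧
        circleFirst t₂.reverse = circs k₂ := by
  constructor
  · intro h
    have h1 : circleFirst (circleFirst t).reverse =
        circs k₂ ++ Part.plain b :: (circs k₀ ++ B).reverse := by
      have := congrArg List.reverse h
      simpa [circleLast, hB, reverse_circs] using this.symm
    obtain ⟨t₂, h2, h3⟩ := circleFirst_eq_append h1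
    have h4 : circleFirst t = circs k₀ ++ Part.plain a :: (A ++ t₂.reverse) := by
      have h5 := congrArg List.reverse h2
      have h6 : circleFirst t = circs k₀ ++ M ++ t₂.reverse := by
        simpa [hB, reverse_circs] using h5
      simpa [hA] using h6
    obtain ⟨t₀, h5, h6⟩ := circleFirst_eq_append h4
    exact ⟨t₀, t₂.reverse, by simp [h5, hA], h6, by simpa using h3⟩
  · rintro ⟨t₀, t₂, rfl, h, h'⟩
    have hne : t₀ ≠ [] := by
      rintro rfl
      exact circs_ne_nil h₀ (by simpa [circleFirst] using h.symm)
    have hne' : t₂ ≠ [] := by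
      rintro rfl
      exact circs_ne_nil h₂ (by simpa [circleFirst] using h'.symm)
    rw [List.append_assoc t₀, circleFirst_append hne, ← List.append_assoc, circleLast_append hne', h]
    simp [circleLast, h', reverse_circs]

/-- The words `w` such that an initial segment of `k` circled `1`s is dominated by a circled `1`
followed by `w`. -/
def endWords (k : ℕ) : Set (List Part) :=
  {w | ∃ t, circleFirst t = circs k ∧ Embeds t (Part.circ :: w)}

/-- The generating function of the shortest words in `endWords k`. -/
noncomputable def gfEnd (k : ℕ) : PowerSeries ℤ := gf (minimalWords (endWords k))

/-- The words that begin and end with a circled `1` and dominate `y`. -/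
def dominating (y : List Part) : Set (List Part) :=
  {z | z.head? = some Part.circ ∧ z.getLast? = some Part.circ ∧
    ∃ t, Embeds t z ∧ y = circleLast (circleFirst t)}

/-- The two circled letters at the ends of a dominating word are forced. Once they are stripped off,
the three factors range freely. -/
theorem dominating_eq {k₀ k₂ a b : ℕ} (h₀ : 1 ≤ k₀) (h₂ : 1 ≤ k₂)
    {M A B : List Part} (hA : M = Part.plain a :: A) (hB : M = B ++ [Part.plain b]) :
    dominating (circs k₀ ++ M ++ circs k₂) =
      (fun w => Part.circ :: (w ++ [Part.circ])) ''
        concat (endWords k₀) (concat (above M) (List.reverse '' endWords k₂)) := by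
  ext z
  simp only [dominating, Set.mem_ofPred_eq, circleLast_circleFirst_eq_iff h₀ h₂ hA hB,
    Set.mem_image, mem_concat]
  constructor
  · rintro ⟨hh, hl, _, ht, t₀, t₂, rfl, h, h'⟩
    rw [List.append_assoc, embeds_append_iff] at ht
    obtain ⟨z₀, z', rfl, e₀, e'⟩ := ht
    obtain ⟨z₁, z₂, rfl, e₁, e₂⟩ := embeds_append_iff.1 e'
    have hne : z₀ ≠ [] := by
      rintro rfl
      have := e₀.length_le
      have : t₀ = [] := by simpa using this
      subst this
      exact circs_ne_nil h₀ (by simpa [circleFirst] using h.symm)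
    have hne' : z₂ ≠ [] := by
      rintro rfl
      have := e₂.length_le
      have : t₂ = [] := by simpa using this
      subst this
      exact circs_ne_nil h₂ (by simpa [circleFirst] using h'.symm)
    obtain ⟨p, u, rfl⟩ := List.exists_cons_of_ne_nil hne
    obtain rfl : p = Part.circ := by simpa using hh
    obtain ⟨v, q, rfl⟩ : ∃ v q, z₂ = v ++ [q] :=
      ⟨_, _, (List.dropLast_append_getLast hne').symm⟩
    obtain rfl : q = Part.circ := by
      rw [← List.append_assoc, ← List.append_assoc, List.getLast?_append] at hl
      simpa using hl
    refine ⟨u ++ (z₁ ++ v), ⟨u, z₁ ++ v, ⟨t₀, h, e₀⟩, ⟨z₁, v, e₁, ⟨v.reverse, ?_, by simp⟩, rfl⟩,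
      rfl⟩, by simp⟩
    exact ⟨t₂.reverse, h', by simpa using embeds_reverse.2 e₂⟩
  · rintro ⟨_, ⟨u, _, ⟨t₀, h, e₀⟩, ⟨z₁, _, e₁, ⟨v, ⟨t₂, h', e₂⟩, rfl⟩, rfl⟩, rfl⟩, rfl⟩
    refine ⟨rfl, by rw [← List.cons_append, List.getLast?_concat], t₀ ++ M ++ t₂.reverse, ?_, t₀, t₂.reverse, rfl,
      h, by simpa using h'⟩
    have e₃ : Embeds t₂.reverse (v.reverse ++ [Part.circ]) := by
      simpa using embeds_reverse.2 e₂
    simpa using (e₀.append e₁).append e₃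

theorem endWords_append {k : ℕ} {u : List Part} (hu : u ∈ endWords k) (v : List Part) :
    u ++ v ∈ endWords k := by
  obtain ⟨t, h, e⟩ := hu
  exact ⟨t, h, e.mono (by simp)⟩

theorem gf_reverse (S : Set (List Part)) : gf (List.reverse '' S) = gf S := by
  rw [gf_image List.reverse_injective 0 (by simp) (fun _ => positive_reverse)]
  simp

/-- The right end is the reversal of a set closed under appending, hence is closed under putting
words in front and can be the last factor of the greedy cut. Its own series is computed after
reversal, and `X ^ 2` accounts for the two forced letters. -/
theorem gf_dominating {k₀ k₂ a b : ℕ} (h₀ : 1 ≤ k₀) (h₂ : 1 ≤ k₂)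
    {M A B : List Part} (hA : M = Part.plain a :: A) (hB : M = B ++ [Part.plain b]) :
    gf (dominating (circs k₀ ++ M ++ circs k₂)) =
      PowerSeries.X ^ 2 * (gfEnd k₀ * (M.map gfPart).prod * gfEnd k₂ * gf Set.univ) := by
  rw [dominating_eq h₀ h₂ hA hB, gf_image (d := 2)]
  · have hl : LeftClosed (List.reverse '' endWords k₂) := by
      rintro u _ ⟨v, hv, rfl⟩
      exact ⟨v ++ u.reverse, endWords_append hv _, by simp⟩
    rw [gf_concat_leftClosed _ (leftClosed_above M).concat, gf_concat_above _ hl, gf_reverse,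
      gf_eq_minimalWords_mul (fun u hu v => endWords_append hu v)]
    simp only [gfEnd, mul_assoc]
  · intro u v h
    simpa using h
  · intro w
    simp [Part.size]; omega
  · intro w
    simp [positive_cons, positive_append, positive_nil, Part.size]

theorem gfEnd_one : gfEnd 1 = 1 := by
  have h : ([] : List Part) ∈ endWords 1 :=
    ⟨[Part.circ], rfl, embeds_singleton_iff.2 ⟨_, by simp, .circ⟩⟩
  have : minimalWords (endWords 1) = {[]} := by
    ext w
    constructor
    · exact fun hw => (hw.2 [] h (List.nil_prefix)).symm
    · rintro rfl
      exact ⟨h, fun u _ hu => by simpa using hu⟩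
  rw [gfEnd, this, gf_singleton positive_nil]
  simp

theorem Embeds.of_cons_cons {p q : Part} {t w : List Part} (h : Embeds (q :: t) (p :: w)) :
    Embeds t w := by
  obtain ⟨u, u', huu, h1, h2⟩ := embeds_append_iff (t := [q]).1 h
  rcases u with _ | ⟨x, u⟩
  · simpa using h1.length_le
  · obtain ⟨rfl, rfl⟩ := by simpa using huu
    exact h2.mono (List.sublist_append_right _ _)

theorem mem_endWords_two {w : List Part} :
    w ∈ endWords 2 ↔ ∃ a ∈ w, a = Part.circ ∨ ∃ k, 2 ≤ k ∧ a = Part.plain k := by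
  constructor
  · rintro ⟨t, ht, e⟩
    have hc : Embeds [Part.circ] w → ∃ a ∈ w, a = Part.circ ∨ ∃ k, 2 ≤ k ∧ a = Part.plain k := by
      rw [embeds_singleton_iff]
      rintro ⟨a, ha, h⟩
      exact ⟨a, ha, .inl (shrink_circ.1 h)⟩
    rcases t with _ | ⟨_ | j, l⟩
    · simp [circleFirst, circs] at ht
    · obtain rfl : l = [Part.circ] := by
        simpa [circleFirst, circs, List.replicate_succ] using ht
      exact hc e.of_cons_cons
    · rcases j with _ | _ | _ | j
      -- A leading `plain 0` is erased by `circleFirst`, so this degenerate `t` has to be treated as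
      -- well.
      · obtain rfl : l = [Part.circ, Part.circ] := by
          simpa [circleFirst, circs, List.replicate_succ] using ht
        obtain ⟨u, u', rfl, h1, h2⟩ := embeds_append_iff (t := [Part.circ]).1 e.of_cons_cons
        exact hc (h1.mono (List.sublist_append_left _ _))
      · obtain rfl : l = [Part.circ] := by
          simpa [circleFirst, circs, List.replicate_succ] using ht
        exact hc e.of_cons_cons
      · obtain rfl : l = [] := by
          simpa [circleFirst, circs, List.replicate_succ] using ht
        obtain ⟨a, ha, h⟩ := embeds_singleton_iff.1 e
        obtain ⟨k, hk, rfl⟩ := (shrink_plain one_le_two).1 h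
        exact ⟨_, by simpa using ha, .inr ⟨k, hk, rfl⟩⟩
      · simp [circleFirst, circs, List.replicate_succ] at ht
  · rintro ⟨a, ha, rfl | ⟨k, hk, rfl⟩⟩
    · exact ⟨[.circ, .circ], rfl, (embeds_singleton_iff.2 ⟨_, by simp, .circ⟩).append (w := [.circ])
        (embeds_singleton_iff.2 ⟨_, ha, .circ⟩)⟩
    · exact ⟨[.plain 2], rfl, embeds_singleton_iff.2
        ⟨_, List.mem_cons_of_mem _ ha, .plain _ _ (by omega) hk⟩⟩

/-- Exchange the circled and the uncircled `1`. -/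
def Part.swapOne : Part → Part
  | .circ => .plain 1
  | .plain k => if k = 1 then .circ else .plain k

theorem Part.swapOne_swapOne (p : Part) : p.swapOne.swapOne = p := by
  rcases p with _ | k
  · simp [swapOne]
  · by_cases hk : k = 1 <;> simp [swapOne, hk]

theorem Part.size_swapOne (p : Part) : p.swapOne.size = p.size := by
  rcases p with _ | k
  · simp [swapOne, size]
  · by_cases hk : k = 1 <;> simp [swapOne, hk, size]

theorem gf_univ_ne_zero : gf Set.univ ≠ 0 := by
  intro h
  have := congrArg (PowerSeries.coeff 0) h
  have hw : words Set.univ 0 = {[]} := by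
    ext w
    constructor
    · rintro ⟨-, h1, h2⟩
      have := length_le_totalSize h1
      simpa [h2] using this
    · rintro rfl
      exact ⟨Set.mem_univ _, positive_nil, rfl⟩
  simp [gf, hw] at this

/-- Both sets are closed under appending, so the full sets can be compared instead of the minimal
words. A positive word misses `endWords 2` when all its letters are uncircled `1`s, and misses
`above [.plain 1]` when all are circled; `Part.swapOne` exchanges the two conditions. -/
theorem gfEnd_two : gfEnd 2 = gfPart (.plain 1) := by
  apply mul_right_cancel₀ gf_univ_ne_zero
  rw [gfEnd, gfPart, ← gf_eq_minimalWords_mul (fun u hu v => endWords_append hu v),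
    ← gf_eq_minimalWords_mul (S := above [.plain 1])
      (fun u hu v => Embeds.mono hu (List.sublist_append_left u v))]
  have hinv : Function.Involutive (List.map Part.swapOne) := fun w => by
    simp [Part.swapOne_swapOne, Function.comp_def]
  have hsize : ∀ w : List Part, totalSize (w.map Part.swapOne) = totalSize w := fun w => by
    simp [totalSize, Part.size_swapOne, Function.comp_def]
  have hpos : ∀ w : List Part, Positive (w.map Part.swapOne) ↔ Positive w := fun w => by
    induction w with
    | nil => simp
    | cons p w ih => simp [positive_cons, ih, Part.size_swapOne]
  have : gf (List.map Part.swapOne '' above [.plain 1]) = gf (above [.plain 1]) := by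
    rw [gf_image hinv.injective 0 hsize hpos]
    simp
  rw [← this]
  congr 1
  ext w
  rw [hinv.image_eq_preimage_symm, Set.mem_preimage, mem_endWords_two]
  simp only [above, Set.mem_ofPred_eq, embeds_singleton_iff, List.mem_map,
    exists_exists_and_eq_and, shrink_plain le_rfl]
  apply exists_congr
  intro a
  apply and_congr_right
  intro _
  rcases a with _ | k
  · simp [Part.swapOne]
  · by_cases hk : k = 1
    · simp [Part.swapOne, hk]
    · simp [Part.swapOne, hk]
      omega

/-! ### Wilf equivalence -/

theorem card_dominates {m : ℕ} (X : CircledComposition m) (N : ℕ) :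
    Nat.card {Z : CircledComposition N // Dominates Z X} = (words (dominating X.parts) N).ncard := by
  rw [← Nat.card_coe_set_eq]
  apply Nat.card_congr
  refine ⟨fun Z => ⟨Z.1.parts, ⟨Z.1.head_circ, Z.1.last_circ, ?_⟩, Z.1.plain_pos, Z.1.sum_size⟩,
    fun w => ⟨⟨w.1, w.2.2.1, w.2.2.2, w.2.1.1, w.2.1.2.1⟩, ?_⟩, fun _ => rfl, fun _ => rfl⟩
  · obtain ⟨s, t, h1, h2, h3⟩ := Z.2
    exact ⟨t, ⟨s, h1, h2⟩, h3⟩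
  · obtain ⟨t, ⟨s, h1, h2⟩, h3⟩ := w.2.1.2.2
    exact ⟨s, t, h1, h2, h3⟩

theorem wilfEquiv_of_gf {m n : ℕ} {X : CircledComposition m} {Y : CircledComposition n}
    (h : gf (dominating X.parts) = gf (dominating Y.parts)) : WilfEquiv X Y := by
  intro N _
  rw [card_dominates, card_dominates]
  have := congrArg (PowerSeries.coeff N) h
  simpa [gf] using this

/-- The product of series that determines the Wilf class of a circled composition with `k₀` and
`k₂` circled `1`s at its ends and, between them, the uncircled parts `P` and `k₁` circled `1`s. -/
noncomputable def classSeries (k₀ : ℕ) (P : List ℕ) (k₁ k₂ : ℕ) : PowerSeries ℤ :=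
  gfEnd k₀ * ((P.map fun a => gfPart (.plain a)).prod * gfPart .circ ^ k₁) * gfEnd k₂

theorem exists_parts (M : List Part) : ∃ (P : List ℕ) (k : ℕ), totalSize M = P.sum + k ∧
    (∀ a ∈ P, Part.plain a ∈ M) ∧
    (M.map gfPart).prod = (P.map fun a => gfPart (.plain a)).prod * gfPart .circ ^ k := by
  induction M with
  | nil => exact ⟨[], 0, by simp⟩
  | cons p M ih =>
    obtain ⟨P, k, h1, h2, h3⟩ := ih
    cases p with
    | circ =>
      refine ⟨P, k + 1, by simp [Part.size, h1]; omega, fun a ha => by simp [h2 a ha], ?_⟩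
      simp only [List.map_cons, List.prod_cons, h3]
      ring
    | plain a =>
      refine ⟨a :: P, k, by simp [Part.size, h1]; omega, ?_, ?_⟩
      · simp only [List.mem_cons]
        rintro b (rfl | hb)
        · simp
        · simp [h2 b hb]
      · simp only [List.map_cons, List.prod_cons, h3]
        ring

theorem eq_circs_or_exists_plain (l : List Part) :
    l = circs (totalSize l) ∨ ∃ k a r, l = circs k ++ Part.plain a :: r := by
  induction l with
  | nil => simp [circs]
  | cons p l ih =>
    cases p with
    | plain a => exact .inr ⟨0, a, l, by simp [circs]⟩
    | circ =>
      rcases ih with h | ⟨k, a, r, rfl⟩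
      · left
        conv_lhs => rw [h]
        rw [totalSize_cons, circs_add]
        simp [circs, Part.size]
      · exact .inr ⟨k + 1, a, r, by simp [circs, List.replicate_succ]⟩

/-- The condition on `k₁` records that circled `1`s away from the ends lie between two uncircled
parts. -/
theorem CircledComposition.exists_data {n : ℕ} (X : CircledComposition n) :
    X.IsAllCircled ∨ ∃ (k₀ : ℕ) (P : List ℕ) (k₁ k₂ : ℕ), 1 ≤ k₀ ∧ 1 ≤ k₂ ∧ P ≠ [] ∧
      (1 ≤ k₁ → 2 ≤ P.length) ∧ (∀ a ∈ P, 1 ≤ a) ∧ k₀ + P.sum + k₁ + k₂ = n ∧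
      gf (dominating X.parts) = PowerSeries.X ^ 2 * (classSeries k₀ P k₁ k₂ * gf Set.univ) := by
  have hsum : totalSize X.parts = n := X.sum_size
  have hpos : Positive X.parts := X.plain_pos
  rcases eq_circs_or_exists_plain X.parts with h | ⟨k₀, a, r, h⟩
  · rw [hsum] at h
    exact .inl h
  right
  rcases eq_circs_or_exists_plain (Part.plain a :: r).reverse with h' | ⟨k₂, b, r', h'⟩
  · have : Part.plain a ∈ (Part.plain a :: r).reverse := by simp
    rw [h'] at this
    simp [circs] at this
  replace h' : Part.plain a :: r = r'.reverse ++ [Part.plain b] ++ circs k₂ := by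
    simpa [reverse_circs] using congrArg List.reverse h'
  set B := r'.reverse
  have h₀ : 1 ≤ k₀ := by
    have := X.head_circ
    rw [h] at this
    rcases k₀ with _ | k
    · simp [circs] at this
    · omega
  have h₂ : 1 ≤ k₂ := by
    have := X.last_circ
    rw [h, h'] at this
    rcases k₂ with _ | k
    · simp [circs] at this
    · omega
  obtain ⟨M, A, hA, hB, hM⟩ : ∃ M A, M = Part.plain a :: A ∧ M = B ++ [Part.plain b] ∧
      X.parts = circs k₀ ++ M ++ circs k₂ := by
    rcases hB : B with _ | ⟨p, B'⟩
    · rw [hB] at h'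
      refine ⟨[Part.plain b], [], ?_, by simp, ?_⟩
      · simp at h' ⊢; exact h'.1.symm
      · rw [h, h']; simp
    · rw [hB] at h'
      refine ⟨p :: B' ++ [Part.plain b], B' ++ [Part.plain b], ?_, rfl, ?_⟩
      · simp at h' ⊢; exact h'.1.symm
      · rw [h, h']; simp
  have hg := gf_dominating h₀ h₂ hA hB
  rw [← hM] at hg
  rw [hM] at hsum hpos
  simp only [totalSize_append, totalSize_circs, positive_append] at hsum hpos
  rcases B with _ | ⟨p, B'⟩
  · obtain rfl : M = [Part.plain b] := hB
    refine ⟨k₀, [b], 0, k₂, h₀, h₂, by simp, by simp, ?_, ?_, ?_⟩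
    · simpa using hpos.1.2 b (by simp)
    · simp [Part.size] at hsum ⊢; omega
    · rw [hg]; simp [classSeries]
  · obtain rfl : p = Part.plain a := by simp [hA] at hB; exact hB.1.symm
    obtain ⟨P, k₁, h1, h2, h3⟩ := exists_parts B'
    have hsize : totalSize M = a + P.sum + k₁ + b := by
      simp [hB, h1, Part.size]; omega
    refine ⟨k₀, a :: (P ++ [b]), k₁, k₂, h₀, h₂, by simp, by simp, ?_, ?_, ?_⟩
    · intro c hc
      apply hpos.1.2
      rw [hB]
      simp only [List.mem_cons, List.mem_append, List.not_mem_nil, or_false] at hc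
      rcases hc with rfl | hc | rfl
      · simp
      · simp [h2 c hc]
      · simp
    · simp only [List.sum_cons, List.sum_append, List.sum_nil]
      omega
    · rw [hg, classSeries, hB]
      simp only [List.map_append, List.map_cons, List.prod_append, List.prod_cons, h3,
        List.cons_append, List.map_nil, List.prod_nil]
      ring

/-- All `k₁` inner circled `1`s go right before the last uncircled part; `hk₁` guarantees that
another uncircled part precedes them. If `k₁ = 0`, the result is a block form. -/
theorem exists_normalForm {n k₀ k₁ k₂ : ℕ} {a : List ℕ} (h₂ : 1 ≤ k₂) (h : k₂ ≤ k₀)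
    (ha : a ≠ []) (hk₁ : 1 ≤ k₁ → 2 ≤ a.length) (hpos : ∀ x ∈ a, 1 ≤ x)
    (hs : a.Pairwise (fun x y => x ≥ y)) (htwo : 2 ≤ a.length → 2 ∉ a) (hk₀ : k₀ ≠ 2)
    (hk₂ : k₂ ≠ 2) (hn : k₀ + a.sum + k₁ + k₂ = n) :
    ∃ Y : CircledComposition n, Y.IsNormalForm ∧
      gf (dominating Y.parts) = PowerSeries.X ^ 2 * (classSeries k₀ a k₁ k₂ * gf Set.univ) := by
  have hmap : ∀ l : List ℕ, totalSize (l.map Part.plain) = l.sum := fun l => by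
    induction l with
    | nil => simp
    | cons x l ih => simp [ih, Part.size]
  have hsplit : a = a.dropLast ++ [a.getLast ha] := (List.dropLast_append_getLast ha).symm
  have hmpos : ∀ l : List ℕ, (∀ x ∈ l, x ∈ a) → Positive (l.map Part.plain) := by
    intro l hl k hk
    simp only [List.mem_map, Part.plain.injEq, exists_eq_right] at hk
    exact hpos k (hl k hk)
  have hhead : ∀ l : List Part, (circs k₀ ++ l).head? = some Part.circ := fun l => by
    obtain ⟨k, rfl⟩ := Nat.exists_eq_add_of_le (h₂.trans h)
    simp [circs, List.replicate_add]
  have hlast : ∀ l : List Part, (l ++ circs k₂).getLast? = some Part.circ := fun l => by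
    simp [circs, List.getLast?_append, List.getLast?_replicate, show k₂ ≠ 0 by omega]
  rcases Nat.eq_zero_or_pos k₁ with rfl | hk
  · refine ⟨⟨circs k₀ ++ a.map Part.plain ++ circs k₂, ?_, ?_, ?_, hlast _⟩, .inr (.inr
      ⟨k₀, k₂, a, rfl, ha, h₂, h, hs, hk₀, hk₂, htwo⟩), ?_⟩
    · exact positive_append.2 ⟨positive_append.2 ⟨positive_circs _, hmpos a (by simp)⟩,
        positive_circs _⟩
    · change totalSize _ = n
      simp [hmap]; omega
    · rw [List.append_assoc]; exact hhead _
    · obtain ⟨x, r, hxr⟩ := List.exists_cons_of_ne_nil ha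
      rw [gf_dominating (a := x) (A := r.map Part.plain) (b := a.getLast ha)
        (B := a.dropLast.map Part.plain) (h₂.trans h) h₂ (by rw [hxr]; simp)
        (by conv_lhs => rw [hsplit]
            simp)]
      simp [classSeries, Function.comp_def]
  · set a' := a.dropLast
    set b := a.getLast ha
    have ha' : a' ≠ [] := by
      have := hk₁ hk
      intro h0
      rw [hsplit, h0] at this
      simp at this
    have hsum : a.sum = a'.sum + b := by conv_lhs => rw [hsplit]
                                         simp
    refine ⟨⟨circs k₀ ++ a'.map Part.plain ++ circs k₁ ++ [Part.plain b] ++ circs k₂, ?_, ?_, ?_,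
      hlast _⟩, .inr (.inl ⟨k₀, k₁, k₂, a', b, rfl, ha', hk, h₂, h, hsplit ▸ hs, ?_, hk₀, hk₂⟩), ?_⟩
    · refine positive_append.2 ⟨positive_append.2 ⟨positive_append.2 ⟨positive_append.2
        ⟨positive_circs _, hmpos a' ?_⟩, positive_circs _⟩, ?_⟩, positive_circs _⟩
      · exact fun x hx => List.dropLast_subset _ hx
      · exact hmpos [b] (by simp [b])
    · change totalSize _ = n
      simp [hmap, Part.size]; omega
    · simp only [List.append_assoc]; exact hhead _
    · rw [← hsplit]; exact htwo (hk₁ hk)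
    · obtain ⟨x, r, hxr⟩ := List.exists_cons_of_ne_nil ha'
      have hassoc : circs k₀ ++ a'.map Part.plain ++ circs k₁ ++ [Part.plain b] ++ circs k₂ =
          circs k₀ ++ (a'.map Part.plain ++ circs k₁ ++ [Part.plain b]) ++ circs k₂ := by simp
      change gf (dominating (circs k₀ ++ a'.map Part.plain ++ circs k₁ ++ [Part.plain b] ++
        circs k₂)) = _
      rw [hassoc, gf_dominating (a := x) (b := b)
        (A := r.map Part.plain ++ circs k₁ ++ [Part.plain b]) (h₂.trans h) h₂
        (by rw [hxr]; simp) rfl, classSeries]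
      conv_rhs => rw [hsplit]
      simp only [List.map_append, List.prod_append, List.map_map, Function.comp_def, List.map_cons,
        List.map_nil, List.prod_cons, List.prod_nil, circs, List.map_replicate,
        List.prod_replicate]
      ring

/-- Circled `1`s at the ends that come in pairs are replaced. -/
theorem exists_ends_ne_two {k₀ k₁ k₂ : ℕ} {P : List ℕ} (h₀ : 1 ≤ k₀) (hP : P ≠ [])
    (hk₁ : 1 ≤ k₁ → 2 ≤ P.length) (hpos : ∀ x ∈ P, 1 ≤ x) :
    ∃ (j₀ : ℕ) (Q : List ℕ), 1 ≤ j₀ ∧ j₀ ≠ 2 ∧ Q ≠ [] ∧ (1 ≤ k₁ → 2 ≤ Q.length) ∧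
      (∀ x ∈ Q, 1 ≤ x) ∧ j₀ + Q.sum = k₀ + P.sum ∧
      classSeries k₀ P k₁ k₂ = classSeries j₀ Q k₁ k₂ := by
  by_cases h : k₀ = 2
  · subst h
    -- Since `gfEnd 2` is the factor of an uncircled `1` and `gfEnd 1 = 1`, one of the two circled
    -- `1`s moves inside and loses its circle.
    refine ⟨1, 1 :: P, le_rfl, by simp, by simp, fun h => ?_, by simpa using hpos, ?_, ?_⟩
    · have := hk₁ h
      simp; omega
    · simp; omega
    · simp only [classSeries, gfEnd_two, gfEnd_one, List.map_cons, List.prod_cons]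
      ring
  · exact ⟨k₀, P, h₀, h, hP, hk₁, hpos, rfl, rfl⟩

theorem classSeries_comm (k₀ k₁ k₂ : ℕ) (P : List ℕ) :
    classSeries k₀ P k₁ k₂ = classSeries k₂ P k₁ k₀ := by
  simp only [classSeries]
  ring

/-- Each `2` becomes an uncircled and a circled `1`. The number of uncircled parts is kept, so there
is still room for the circled ones if there were two such parts. -/
theorem exists_two_notMem (P : List ℕ) (hpos : ∀ x ∈ P, 1 ≤ x) : ∃ (Q : List ℕ) (k : ℕ),
    Q.length = P.length ∧ 2 ∉ Q ∧ (∀ x ∈ Q, 1 ≤ x) ∧ Q.sum + k = P.sum ∧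
    (P.map fun a => gfPart (.plain a)).prod =
      (Q.map fun a => gfPart (.plain a)).prod * gfPart .circ ^ k := by
  induction P with
  | nil => exact ⟨[], 0, by simp⟩
  | cons x P ih =>
    obtain ⟨Q, k, h1, h2, h3, h4, h5⟩ := ih (fun x hx => hpos x (by simp [hx]))
    by_cases hx : x = 2
    · refine ⟨1 :: Q, k + 1, by simp [h1], by simp [h2], by simpa using h3, ?_, ?_⟩
      · simp; omega
      · simp only [List.map_cons, List.prod_cons, h5, hx, gfPart_two_eq]
        ring
    · refine ⟨x :: Q, k, by simp [h1], by simp [h2, Ne.symm hx], ?_, ?_, ?_⟩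
      · simpa using ⟨hpos x (by simp), h3⟩
      · simp; omega
      · simp only [List.map_cons, List.prod_cons, h5]
        ring

theorem exists_normalForm_wilfEquiv {n : ℕ} (X : CircledComposition n) :
    ∃ Y : CircledComposition n, Y.IsNormalForm ∧ WilfEquiv X Y := by
  rcases X.exists_data with h | ⟨k₀, P, k₁, k₂, h₀, h₂, hP, hk₁, hpos, hn, hX⟩
  · exact ⟨X, .inl h, fun _ _ => rfl⟩
  suffices ∃ Y : CircledComposition n, Y.IsNormalForm ∧ gf (dominating Y.parts) =
      PowerSeries.X ^ 2 * (classSeries k₀ P k₁ k₂ * gf Set.univ) by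
    obtain ⟨Y, hY, h⟩ := this
    exact ⟨Y, hY, wilfEquiv_of_gf (hX.trans h.symm)⟩
  clear hX
  obtain ⟨j₀, Q, hj₀, hj₀', hQ, hkQ, hposQ, hsQ, hcQ⟩ :=
    exists_ends_ne_two (k₂ := k₂) h₀ hP hk₁ hpos
  obtain ⟨j₂, R, hj₂, hj₂', hR, hkR, hposR, hsR, hcR⟩ :=
    exists_ends_ne_two (k₂ := j₀) h₂ hQ hkQ hposQ
  rw [hcQ, classSeries_comm, hcR]
  have hn' : j₂ + R.sum + k₁ + j₀ = n := by omega
  clear hcQ hcR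
  obtain ⟨S, j₁, hS, hkS, hposS, hsS, htwo, hcS⟩ : ∃ (S : List ℕ) (j₁ : ℕ), S ≠ [] ∧
      (1 ≤ j₁ → 2 ≤ S.length) ∧ (∀ x ∈ S, 1 ≤ x) ∧ S.sum + j₁ = R.sum + k₁ ∧
      (2 ≤ S.length → 2 ∉ S) ∧ classSeries j₂ R k₁ j₀ = classSeries j₂ S j₁ j₀ := by
    -- With a single uncircled part no place is left for an inner circled `1`, so there a `2` has to
    -- stay.
    by_cases hl : 2 ≤ R.length
    · obtain ⟨S, k, h1, h2, h3, h4, h5⟩ := exists_two_notMem R hposR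
      refine ⟨S, k + k₁, ?_, fun _ => by omega, h3, by omega, fun _ => h2, ?_⟩
      · rintro rfl
        simp at h1
        omega
      · simp only [classSeries, h5, pow_add]
        ring
    · exact ⟨R, k₁, hR, hkR, hposR, rfl, fun h => absurd h hl, rfl⟩
  rw [hcS]
  set a := S.insertionSort (fun x y => x ≥ y)
  have hperm : a.Perm S := List.perm_insertionSort _ _
  have hca : ∀ i j, classSeries i S j₁ j = classSeries i a j₁ j := fun i j => by
    simp only [classSeries, (hperm.map fun a => gfPart (.plain a)).prod_eq]
  have ha : a ≠ [] := fun h => hS (by simpa [h] using hperm)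
  have hka : 1 ≤ j₁ → 2 ≤ a.length := by rwa [hperm.length_eq]
  have hposa : ∀ x ∈ a, 1 ≤ x := fun x hx => hposS x (hperm.mem_iff.1 hx)
  have htwo' : 2 ≤ a.length → 2 ∉ a := by rwa [hperm.length_eq, hperm.mem_iff]
  have hsa : a.Pairwise (fun x y => x ≥ y) := List.pairwise_insertionSort _ _
  have hsum := hperm.sum_eq
  rcases le_total j₀ j₂ with h | h
  · rw [hca]
    exact exists_normalForm hj₀ h ha hka hposa hsa htwo' hj₂' hj₀' (by omega)
  · rw [hca, classSeries_comm]
    exact exists_normalForm hj₂ h ha hka hposa hsa htwo' hj₀' hj₂' (by omega)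

/-! ### The words of a circled composition -/

theorem uncircledWord_append (l l' : List Part) (s : ℕ) :
    uncircledWord (l ++ l') s = uncircledWord l' (s + totalSize l) ++ uncircledWord l s := by
  induction l generalizing s with
  | nil => simp [uncircledWord]
  | cons p l ih => cases p <;> simp [uncircledWord, ih, Part.size, add_assoc]

theorem circledWord_append (l l' : List Part) (s : ℕ) :
    circledWord (l ++ l') s = circledWord l s ++ circledWord l' (s + totalSize l) := by
  induction l generalizing s with
  | nil => simp [circledWord]
  | cons p l ih => cases p <;> simp [circledWord, ih, Part.size, add_assoc]

theorem uncircledWord_circs (k s : ℕ) : uncircledWord (circs k) s = [] := by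
  induction k generalizing s with
  | zero => rfl
  | succ k ih => exact ih (s + 1)

theorem circledWord_circs (k s : ℕ) : circledWord (circs k) s = List.range' s k := by
  induction k generalizing s with
  | zero => rfl
  | succ k ih => exact congrArg (s :: ·) (ih (s + 1))

theorem word_perm (l : List Part) (s : ℕ) :
    (uncircledWord l s ++ circledWord l s).Perm (List.range' s (totalSize l)) := by
  induction l generalizing s with
  | nil => simp [uncircledWord, circledWord]
  | cons p l ih =>
    cases p with
    | circ =>
      rw [totalSize_cons, Part.size, add_comm 1, List.range'_succ]
      exact List.perm_middle.trans ((ih (s + 1)).cons s)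
    | plain k =>
      have h : List.range' s k ++ List.range' (s + k) (totalSize l) =
          List.range' s (k + totalSize l) := by
        simp
      rw [totalSize_cons, Part.size, ← h, uncircledWord, circledWord, List.append_assoc]
      exact (List.perm_append_comm_assoc _ _ _).trans ((ih (s + k)).append_left _)

theorem mem_word {l : List Part} {s x : ℕ} :
    x ∈ uncircledWord l s ∨ x ∈ circledWord l s ↔ s ≤ x ∧ x < s + totalSize l := by
  rw [← List.mem_append, (word_perm l s).mem_iff, List.mem_range'_1]

theorem circledWord_pairwise (l : List Part) (s : ℕ) :
    (circledWord l s).Pairwise (· < ·) := by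
  induction l generalizing s with
  | nil => simp [circledWord]
  | cons p l ih =>
    cases p with
    | circ =>
      refine List.pairwise_cons.2 ⟨fun x hx => ?_, ih _⟩
      have := (mem_word.1 (.inr hx)).1
      omega
    | plain k => exact ih _

/-- The word that represents the circular permutation of a circled composition. -/
def word (l : List Part) : List ℕ := uncircledWord l 1 ++ circledWord l 1

theorem length_word (l : List Part) : (word l).length = totalSize l := by
  simpa [word] using (word_perm l 1).length_eq

theorem nodup_word (l : List Part) : (word l).Nodup :=
  (word_perm l 1).nodup_iff.2 (List.nodup_range' (step := 1))

/-- The interval of a leading uncircled part is the last uncircled run and borders on the circled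
numbers, all of which are larger; circling it only moves the boundary. -/
theorem word_circleFirst (t : List Part) : word (circleFirst t) = word t := by
  rcases t with _ | ⟨_ | k, l⟩
  · rfl
  · rfl
  · change word (circs k ++ l) = _
    simp [word, uncircledWord_append, circledWord_append, uncircledWord_circs, circledWord_circs,
      uncircledWord, circledWord]

/-- The interval of a final uncircled part stands first in the word; circling it moves it to the
very end, which is a rotation. -/
theorem word_circleLast (t : List Part) : word (circleLast t) ~r word t := by
  rcases List.eq_nil_or_concat t with rfl | ⟨l, p, rfl⟩
  · rfl
  · rw [List.concat_eq_append]
    cases p with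
    | circ =>
      simp only [circleLast, circleFirst, List.reverse_append, List.reverse_cons, List.reverse_nil,
        List.nil_append, List.cons_append, List.reverse_reverse]
      rfl
    | plain k =>
      have : circleLast (l ++ [Part.plain k]) = l ++ circs k := by
        simp [circleLast, circleFirst, circs]
      rw [this]
      simp only [word, uncircledWord_append, circledWord_append, uncircledWord_circs,
        circledWord_circs, uncircledWord, circledWord, List.nil_append, List.append_nil]
      rw [← List.append_assoc, List.append_assoc (List.range' _ _)]
      exact List.isRotated_append

theorem word_circleLast_circleFirst (t : List Part) :
    word (circleLast (circleFirst t)) ~r word t :=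
  (word_circleLast _).trans (by rw [word_circleFirst])

theorem getLast?_circleFirst {r : List Part} (h : r.getLast? = some Part.circ) :
    (circleFirst r).getLast? = some Part.circ := by
  rcases r with _ | ⟨_ | k, l⟩
  · simp at h
  · exact h
  · have hl : l ≠ [] := by rintro rfl; simp at h
    rw [List.getLast?_cons_of_ne_nil hl] at h
    simp [circleFirst, List.getLast?_append, h]

theorem head?_circleFirst {t : List Part} (ht : t ≠ []) (hp : Positive t) :
    (circleFirst t).head? = some Part.circ := by
  rcases t with _ | ⟨_ | k, l⟩
  · simp at ht
  · rfl
  · have : 1 ≤ k := hp k (by simp)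
    obtain ⟨j, rfl⟩ := Nat.exists_eq_add_of_le' this
    simp [circleFirst, List.replicate_succ]

theorem positive_circleFirst {t : List Part} (hp : Positive t) : Positive (circleFirst t) := by
  rcases t with _ | ⟨_ | k, l⟩
  · exact hp
  · exact hp
  · exact positive_append.2 ⟨positive_circs k, (positive_cons.1 hp).2⟩

/-- The list of parts is that of a circled composition. -/
structure IsCircled (y : List Part) : Prop where
  pos : Positive y
  head : y.head? = some Part.circ
  last : y.getLast? = some Part.circ

theorem isCircled_circleLast_circleFirst {t : List Part} (ht : t ≠ []) (hp : Positive t) :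
    IsCircled (circleLast (circleFirst t)) := by
  have h1 := head?_circleFirst ht hp
  have h2 := positive_circleFirst hp
  have hne : circleFirst t ≠ [] := by
    intro h
    simp [h] at h1
  refine ⟨positive_reverse.2 (positive_circleFirst (positive_reverse.2 h2)), ?_, ?_⟩
  · rw [circleLast, List.head?_reverse]
    exact getLast?_circleFirst (by rwa [List.getLast?_reverse])
  · rw [circleLast, List.getLast?_reverse]
    exact head?_circleFirst (by simpa using hne) (positive_reverse.2 h2)

theorem CircledComposition.isCircled {n : ℕ} (X : CircledComposition n) : IsCircled X.parts :=
  ⟨X.plain_pos, X.head_circ, X.last_circ⟩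

theorem IsCircled.exists_circledWord_eq {y : List Part} (h : IsCircled y) :
    ∃ c, circledWord y 1 = 1 :: c := by
  rcases y with _ | ⟨_ | k, l⟩
  · simpa using h.head
  · exact ⟨_, rfl⟩
  · simpa using h.head

theorem IsCircled.totalSize_mem {y : List Part} (h : IsCircled y) :
    totalSize y ∈ circledWord y 1 := by
  rcases List.eq_nil_or_concat y with rfl | ⟨l, p, rfl⟩
  · simpa using h.head
  · have := h.last
    rw [List.concat_eq_append, List.getLast?_concat, Option.some.injEq] at this
    subst this
    simp [circledWord_append, circledWord, Part.size, add_comm]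

/-! ### The circular permutation determines the circled composition -/

/-- Induction from the left: the word that contains the smallest number `s` tells whether the first
part is circled. -/
theorem eq_of_words_eq {y y' : List Part} (hy : Positive y) (hy' : Positive y') {s : ℕ}
    (hu : uncircledWord y s = uncircledWord y' s) (hc : circledWord y s = circledWord y' s) :
    y = y' := by
  induction y generalizing y' s with
  | nil =>
    have h := (word_perm y' s).length_eq
    rw [← hu, ← hc] at h
    have := length_le_totalSize hy'
    simp [uncircledWord, circledWord] at h
    rw [← h] at this
    exact (List.length_eq_zero_iff.1 (Nat.le_zero.1 this)).symm
  | cons p l ih =>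
    have aux : ∀ k (l' : List Part), 1 ≤ k → s ∉ uncircledWord l' (s + k) ∧
        s ∉ circledWord l' (s + k) := by
      intro k l' hk
      have := mem_word (l := l') (s := s + k) (x := s)
      constructor <;> intro h <;> simp [h] at this <;> omega
    rw [positive_cons] at hy
    rcases y' with _ | ⟨p', l'⟩
    · have h := (word_perm (p :: l) s).length_eq
      rw [hu, hc] at h
      simp [uncircledWord, circledWord] at h
      omega
    rw [positive_cons] at hy'
    rcases p with _ | k <;> rcases p' with _ | k'
    · rw [ih hy.2 hy'.2 hu (List.cons.inj hc).2]
    · simp only [circledWord] at hc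
      exact absurd (hc ▸ List.mem_cons_self) (aux k' l' hy'.1).2
    · simp only [circledWord] at hc
      exact absurd (hc ▸ List.mem_cons_self) (aux k l hy.1).2
    · simp only [Part.size] at hy hy'
      simp only [uncircledWord, circledWord] at hu hc
      -- The last uncircled run begins with `s`, which occurs nowhere earlier. Were the two runs of
      -- different lengths, `s` would fall into the part before the shorter one.
      have key : ∀ {i i' : ℕ} {v v' : List ℕ}, 1 ≤ i → s ∉ v' →
          v' = v ++ (v'.drop v.length) → List.range' s i = v'.drop v.length ++ List.range' s i' →
          v = v' ∧ i = i' := by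
        intro i i' v v' hi hv' h1 h2
        rcases hd : v'.drop v.length with _ | ⟨x, d⟩
        · rw [hd] at h1 h2
          exact ⟨by simpa using h1.symm, by simpa using congrArg List.length h2⟩
        · rw [hd] at h1 h2
          obtain ⟨j, rfl⟩ := Nat.exists_eq_add_of_le' hi
          simp only [List.range'_succ, List.cons_append, List.cons.injEq] at h2
          exact absurd (by rw [h1]; simp [h2.1]) hv'
      have hkk : uncircledWord l (s + k) = uncircledWord l' (s + k') ∧ k = k' := by
        rcases List.append_eq_append_iff.1 hu with ⟨d, h1, h2⟩ | ⟨d, h1, h2⟩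
        · have hd : (uncircledWord l' (s + k')).drop (uncircledWord l (s + k)).length = d := by
            simp [h1]
          exact key (i := k) (i' := k') hy.1 (aux k' l' hy'.1).1 (by rw [hd]; exact h1)
            (by rw [hd]; exact h2)
        · have hd : (uncircledWord l (s + k)).drop (uncircledWord l' (s + k')).length = d := by
            simp [h1]
          have := key (i := k') (i' := k) hy'.1 (aux k l hy.1).1 (by rw [hd]; exact h1)
            (by rw [hd]; exact h2)
          exact ⟨this.1.symm, this.2.symm⟩
      obtain ⟨h1, rfl⟩ := hkk
      rw [ih hy.2 hy'.2 h1 hc]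

theorem eq_of_cons_isRotated_cons {α : Type*} {a : α} {l l' : List α} (hl : (a :: l).Nodup)
    (h : (a :: l) ~r (a :: l')) : l = l' := by
  obtain ⟨k, hk, hr⟩ := List.isRotated_iff_mod.1 h
  have hlen := h.perm.length_eq
  rcases hk.eq_or_lt with rfl | hk
  · rw [List.rotate_length] at hr
    exact (List.cons.inj hr).2
  · have h1 := List.head?_rotate hk
    rw [hr, List.head?_cons, eq_comm, List.getElem?_eq_some_iff] at h1
    obtain ⟨h1, h2⟩ := h1
    have : k = 0 := (List.Nodup.getElem_inj_iff hl (hj := by simp)).1 h2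
    subst this
    rw [List.rotate_zero] at hr
    exact (List.cons.inj hr).2

theorem eq_of_append_eq_append_of_mem {C C' U U' : List ℕ} {m : ℕ}
    (hC' : C'.Pairwise (· < ·)) (hm : m ∈ C) (hle : ∀ x ∈ C', x ≤ m)
    {d : List ℕ} (h : C' = C ++ d) (hU : U = d ++ U') : C = C' ∧ U = U' := by
  rcases d with _ | ⟨x, d⟩
  · exact ⟨by simp [h], by simp [hU]⟩
  · rw [h, List.pairwise_append] at hC'
    have h1 := hC'.2.2 m hm x (by simp)
    have h2 := hle x (by simp [h])
    omega

theorem word_isRotated (y : List Part) : word y ~r (circledWord y 1 ++ uncircledWord y 1) :=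
  List.isRotated_append

/-- Rotate so that `1` comes first. The circled numbers increase from `1` to the maximum `totalSize
y`, so they are exactly the stretch up to the maximum, and the uncircled numbers are the rest. -/
theorem IsCircled.eq_of_word_isRotated {y y' : List Part} (hy : IsCircled y) (hy' : IsCircled y')
    (h : word y ~r word y') : y = y' := by
  have hsize : totalSize y = totalSize y' := by
    rw [← length_word, ← length_word, h.perm.length_eq]
  have h1 := ((word_isRotated y).symm.trans h).trans (word_isRotated y')
  have hnd : (circledWord y 1 ++ uncircledWord y 1).Nodup :=
    (word_isRotated y).perm.nodup_iff.1 (nodup_word y)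
  have hle : ∀ z : List Part, ∀ x ∈ circledWord z 1, x ≤ totalSize z := by
    intro z x hx
    have := (mem_word.1 (.inr hx)).2
    omega
  have heq : circledWord y 1 ++ uncircledWord y 1 = circledWord y' 1 ++ uncircledWord y' 1 := by
    obtain ⟨c, hc⟩ := hy.exists_circledWord_eq
    obtain ⟨c', hc'⟩ := hy'.exists_circledWord_eq
    rw [hc, hc'] at h1 ⊢
    rw [hc] at hnd
    exact congrArg (1 :: ·) (eq_of_cons_isRotated_cons hnd h1)
  have hm := hy.totalSize_mem
  have hm' := hy'.totalSize_mem
  have : circledWord y 1 = circledWord y' 1 ∧ uncircledWord y 1 = uncircledWord y' 1 := by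
    rcases List.append_eq_append_iff.1 heq with ⟨d, h2, h3⟩ | ⟨d, h2, h3⟩
    · exact eq_of_append_eq_append_of_mem (circledWord_pairwise _ _) hm
        (by rw [hsize]; exact hle y') h2 h3
    · have := eq_of_append_eq_append_of_mem (circledWord_pairwise _ _) hm'
        (by rw [← hsize]; exact hle y) h2 h3
      exact ⟨this.1.symm, this.2.symm⟩
  exact eq_of_words_eq hy.pos hy'.pos this.2 this.1

/-! ### Order isomorphism -/

theorem OrderIsomorphic.symm {s p : List ℕ} (h : OrderIsomorphic s p) : OrderIsomorphic p s := by
  obtain ⟨h, h'⟩ := h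
  exact ⟨h.symm, fun i j => (h' (i.cast h.symm) (j.cast h.symm)).symm⟩

theorem OrderIsomorphic.trans {s p q : List ℕ} (h : OrderIsomorphic s p)
    (h' : OrderIsomorphic p q) : OrderIsomorphic s q := by
  obtain ⟨h1, h2⟩ := h
  obtain ⟨h3, h4⟩ := h'
  exact ⟨h1.trans h3, fun i j => (h2 i j).trans (h4 (i.cast h1) (j.cast h1))⟩

theorem orderIsomorphic_map {p : List ℕ} {f : ℕ → ℕ} (hf : StrictMonoOn f {x | x ∈ p}) :
    OrderIsomorphic (p.map f) p := by
  refine ⟨by simp, fun i j => ?_⟩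
  simp only [List.get_eq_getElem, List.getElem_map, Fin.val_cast]
  exact hf.lt_iff_lt (List.getElem_mem _) (List.getElem_mem _)

theorem OrderIsomorphic.exists_map {s p : List ℕ} (hp : p.Nodup) (h : OrderIsomorphic s p) :
    ∃ f : ℕ → ℕ, StrictMonoOn f {x | x ∈ p} ∧ s = p.map f := by
  obtain ⟨hl, h⟩ := h
  have key : ∀ i (hi : i < p.length), s.getD (p.idxOf p[i]) 0 = s[i]'(hl ▸ hi) := by
    intro i hi
    rw [List.Nodup.idxOf_getElem hp]
    simp [hl, hi]
  refine ⟨fun x => s.getD (p.idxOf x) 0, ?_, ?_⟩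
  · intro x hx y hy hxy
    obtain ⟨i, hi, rfl⟩ := List.getElem_of_mem hx
    obtain ⟨j, hj, rfl⟩ := List.getElem_of_mem hy
    simp only [key]
    exact (h ⟨i, hl ▸ hi⟩ ⟨j, hl ▸ hj⟩).2 hxy
  · apply List.ext_getElem (by simpa using hl)
    intro i h1 h2
    simp only [List.getElem_map]
    rw [key]

/-- A strictly increasing map of `{1, …, k}` to itself is the identity: `x ≤ f x` by upward and `f x
≤ x` by downward induction. -/
theorem eq_of_orderIsomorphic {p q : List ℕ} {m k : ℕ} (hp : p.Perm (List.range' 1 m))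
    (hq : q.Perm (List.range' 1 k)) (h : OrderIsomorphic p q) : p = q := by
  obtain ⟨f, hf, rfl⟩ := h.exists_map (hq.nodup_iff.2 (List.nodup_range' (step := 1)))
  have hmk : k = m := by
    have h1 := hp.length_eq
    have h2 := hq.length_eq
    simp at h1 h2
    omega
  subst hmk
  have hmem : ∀ x, x ∈ q ↔ 1 ≤ x ∧ x ≤ k := by
    intro x
    rw [hq.mem_iff, List.mem_range'_1]
    omega
  have hbd : ∀ x ∈ q, 1 ≤ f x ∧ f x ≤ k := by
    intro x hx
    have := hp.mem_iff.1 (List.mem_map_of_mem hx)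
    rw [List.mem_range'_1] at this
    omega
  have hge : ∀ x, x ∈ q → x ≤ f x := by
    intro x
    induction x with
    | zero => simp
    | succ x ih =>
      intro hx
      rcases Nat.eq_zero_or_pos x with rfl | h0
      · exact (hbd _ hx).1
      · have hx' : x ∈ q := by rw [hmem] at hx ⊢; omega
        have := hf hx' hx (Nat.lt_succ_self x)
        have := ih hx'
        omega
  have hle : ∀ d x, x + d = k → x ∈ q → f x ≤ x := by
    intro d
    induction d with
    | zero => rintro x rfl hx; exact (hbd _ hx).2
    | succ d ih =>
      intro x hd hx
      have hx' : x + 1 ∈ q := by rw [hmem] at hx ⊢; omega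
      have := hf hx hx' (Nat.lt_succ_self x)
      have := ih (x + 1) (by omega) hx'
      omega
  conv_rhs => rw [← List.map_id q]
  apply List.map_congr_left
  intro x hx
  exact le_antisymm (hle (k - x) x (by rw [hmem] at hx; omega) hx) (hge x hx)

/-! ### Subsequences of the words -/

/-- Selected and shrunk parts correspond to selected numbers; one increasing relabelling `f` must
serve both words, so it is built interval by interval. The bound `s ≤ f x` is what lets the
induction glue the pieces. -/
theorem exists_sublist_of_embeds {t w : List Part} (h : Embeds t w) (s s' : ℕ) :
    ∃ f : ℕ → ℕ, StrictMonoOn f (Set.Ico s' (s' + totalSize t)) ∧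
      (∀ x ∈ Set.Ico s' (s' + totalSize t), s ≤ f x) ∧
      ((uncircledWord t s').map f).Sublist (uncircledWord w s) ∧
      ((circledWord t s').map f).Sublist (circledWord w s) := by
  induction w generalizing t s s' with
  | nil =>
    obtain rfl : t = [] := by simpa using h.length_le
    exact ⟨id, by simp [uncircledWord, circledWord, StrictMonoOn]⟩
  | cons p w ih =>
    obtain ⟨u, hu, hs⟩ := h
    rcases List.sublist_cons_iff.1 hu with hu' | ⟨u, rfl, hu'⟩
    · obtain ⟨f, h1, h2, h3, h4⟩ := ih ⟨u, hu', hs⟩ (s + p.size) s'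
      refine ⟨f, h1, fun x hx => (Nat.le_add_right _ _).trans (h2 x hx), ?_, ?_⟩
      · cases p with
        | circ => exact h3
        | plain k => exact h3.trans (List.sublist_append_left _ _)
      · cases p with
        | circ => exact h4.trans (List.sublist_cons_self _ _)
        | plain k => exact h4
    · obtain ⟨q, t, hpq, hs', rfl⟩ := List.forall₂_cons_left_iff.1 hs
      have hqp : q.size ≤ p.size := by cases hpq <;> simp [Part.size, *]
      obtain ⟨f, h1, h2, h3, h4⟩ := ih (t := t) ⟨u, hu', hs'⟩ (s + p.size) (s' + q.size)
      set g : ℕ → ℕ := fun x => if x < s' + q.size then x - s' + s else f x with hg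
      have hgf : ∀ l : List ℕ, (∀ x ∈ l, s' + q.size ≤ x) → l.map g = l.map f := by
        intro l hl
        apply List.map_congr_left
        intro x hx
        have := hl x hx
        simp [hg]
        omega
      have hgu : (uncircledWord t (s' + q.size)).map g = (uncircledWord t (s' + q.size)).map f :=
        hgf _ fun x hx => (mem_word.1 (.inl hx)).1
      have hgc : (circledWord t (s' + q.size)).map g = (circledWord t (s' + q.size)).map f :=
        hgf _ fun x hx => (mem_word.1 (.inr hx)).1
      refine ⟨g, ?_, ?_, ?_, ?_⟩
      · intro x hx y hy hxy
        simp only [Set.mem_Ico, totalSize_cons] at hx hy h2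
        simp only [hg]
        split_ifs with hx' hy' hy'
        · omega
        · have := h2 y ⟨by omega, by omega⟩
          omega
        · omega
        · exact h1 (Set.mem_Ico.2 ⟨by omega, by omega⟩) (Set.mem_Ico.2 ⟨by omega, by omega⟩) hxy
      · intro x hx
        simp only [Set.mem_Ico, totalSize_cons] at hx h2
        simp only [hg]
        split_ifs with hx'
        · omega
        · have := h2 x ⟨by omega, by omega⟩
          omega
      · cases hpq with
        | circ => simpa only [uncircledWord, ← hgu] using hgu ▸ h3
        | plain j k hj hjk =>
          simp only [Part.size] at hgu h3
          simp only [uncircledWord, List.map_append, hgu]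
          refine h3.append ?_
          have : (List.range' s' j).map g = List.range' s j := by
            apply List.ext_getElem (by simp)
            intro i hi1 hi2
            simp only [List.length_range'] at hi2
            simp only [hg, Part.size, List.getElem_map, List.getElem_range', one_mul]
            rw [if_pos (by omega)]
            omega
          rw [this]
          exact List.range'_sublist_right.2 hjk
      · cases hpq with
        | circ =>
          simp only [Part.size] at hgc h4
          simp only [circledWord, List.map_cons, hgc]
          have : g s' = s := by simp [hg, Part.size]
          rw [this]
          exact h4.cons_cons s
        | plain j k hj hjk => simpa only [circledWord, ← hgc] using hgc ▸ h4

/-- The converse: the numbers chosen from an uncircled run form one part, whose value is how many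
were chosen. -/
theorem exists_embeds_of_sublist {w : List Part} {su sc : List ℕ} {s : ℕ}
    (hu : su.Sublist (uncircledWord w s)) (hc : sc.Sublist (circledWord w s)) (s' : ℕ) :
    ∃ t, Embeds t w ∧ ∃ f : ℕ → ℕ, StrictMonoOn f (Set.Ico s' (s' + totalSize t)) ∧
      (∀ x ∈ Set.Ico s' (s' + totalSize t), s ≤ f x) ∧
      su = (uncircledWord t s').map f ∧ sc = (circledWord t s').map f := by
  induction w generalizing su sc s s' with
  | nil =>
    simp only [uncircledWord, circledWord, List.sublist_nil] at hu hc
    subst hu hc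
    exact ⟨[], embeds_nil _, id, by simp [uncircledWord, circledWord, StrictMonoOn]⟩
  | cons p w ih =>
    have skip : ∀ su sc : List ℕ, su.Sublist (uncircledWord w (s + p.size)) →
        sc.Sublist (circledWord w (s + p.size)) →
        ∃ t, Embeds t (p :: w) ∧ ∃ f : ℕ → ℕ, StrictMonoOn f (Set.Ico s' (s' + totalSize t)) ∧
          (∀ x ∈ Set.Ico s' (s' + totalSize t), s ≤ f x) ∧
          su = (uncircledWord t s').map f ∧ sc = (circledWord t s').map f := by
      intro su sc hu hc
      obtain ⟨t, ht, f, h1, h2, h3⟩ := ih hu hc s'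
      exact ⟨t, ht.mono (List.sublist_cons_self _ _), f, h1,
        fun x hx => (Nat.le_add_right _ _).trans (h2 x hx), h3⟩
    have glue : ∀ (q : Part) (t : List Part) (r : List ℕ) (f : ℕ → ℕ), r.length = q.size →
        r.Sublist (List.range' s p.size) →
        StrictMonoOn f (Set.Ico (s' + q.size) (s' + q.size + totalSize t)) →
        (∀ x ∈ Set.Ico (s' + q.size) (s' + q.size + totalSize t), s + p.size ≤ f x) →
        ∃ g : ℕ → ℕ, StrictMonoOn g (Set.Ico s' (s' + totalSize (q :: t))) ∧
          (∀ x ∈ Set.Ico s' (s' + totalSize (q :: t)), s ≤ g x) ∧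
          (uncircledWord t (s' + q.size)).map g = (uncircledWord t (s' + q.size)).map f ∧
          (circledWord t (s' + q.size)).map g = (circledWord t (s' + q.size)).map f ∧
          (List.range' s' q.size).map g = r := by
      intro q t r f hr hrs h1 h2
      set g : ℕ → ℕ := fun x => if x < s' + q.size then r.getD (x - s') 0 else f x with hg
      have hgf : ∀ l : List ℕ, (∀ x ∈ l, s' + q.size ≤ x) → l.map g = l.map f := by
        intro l hl
        apply List.map_congr_left
        intro x hx
        have := hl x hx
        simp [hg]
        omega
      have hrp : r.Pairwise (· < ·) := List.Pairwise.sublist hrs (List.pairwise_lt_range' ..)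
      have hrm : ∀ x (hx : x < r.length), s ≤ r[x] ∧ r[x] < s + p.size := by
        intro x hx
        have := hrs.subset (List.getElem_mem hx)
        rwa [List.mem_range'_1] at this
      have hget : ∀ x (hx : x < q.size), r.getD x 0 = r[x]'(hr ▸ hx) := by
        intro x hx
        simp [hr, hx]
      refine ⟨g, ?_, ?_, ?_, ?_, ?_⟩
      · intro x hx y hy hxy
        simp only [Set.mem_Ico, totalSize_cons] at hx hy h2
        simp only [hg]
        split_ifs with hx' hy' hy'
        · rw [hget _ (by omega), hget _ (by omega)]
          exact List.pairwise_iff_getElem.1 hrp _ _ _ _ (by omega)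
        · have h3 := h2 y ⟨by omega, by omega⟩
          rw [hget _ (by omega)]
          have := (hrm (x - s') (by omega)).2
          omega
        · omega
        · exact h1 (Set.mem_Ico.2 ⟨by omega, by omega⟩) (Set.mem_Ico.2 ⟨by omega, by omega⟩) hxy
      · intro x hx
        simp only [Set.mem_Ico, totalSize_cons] at hx h2
        simp only [hg]
        split_ifs with hx'
        · rw [hget _ (by omega)]
          exact (hrm (x - s') (by omega)).1
        · have := h2 x ⟨by omega, by omega⟩
          omega
      · exact hgf _ fun x hx => (mem_word.1 (.inl hx)).1
      · exact hgf _ fun x hx => (mem_word.1 (.inr hx)).1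
      · apply List.ext_getElem (by simpa using hr.symm)
        intro i hi1 hi2
        simp [hg, hr ▸ hi2, hi2]
    cases p with
    | circ =>
      simp only [uncircledWord, circledWord] at hu hc
      rcases List.sublist_cons_iff.1 hc with hc' | ⟨sc, rfl, hc'⟩
      · exact skip su sc hu hc'
      · obtain ⟨t, ⟨v, hv, hvt⟩, f, h1, h2, rfl, rfl⟩ := ih hu hc' (s' + 1)
        obtain ⟨g, g1, g2, g3, g4, g5⟩ := glue .circ t [s] f rfl (by simp [Part.size]) h1 h2
        refine ⟨.circ :: t, ⟨.circ :: v, hv.cons_cons _, .cons .circ hvt⟩, g, g1, g2, g3.symm, ?_⟩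
        simp only [Part.size] at g4 g5
        simp at g5
        simp [circledWord, g4, g5]
    | plain k =>
      simp only [uncircledWord, circledWord] at hu hc
      obtain ⟨su, r, rfl, hu', hr⟩ := List.sublist_append_iff.1 hu
      -- A part cannot shrink to `0`; a run from which nothing is chosen corresponds to a part left
      -- out of the subsequence.
      rcases Nat.eq_zero_or_pos r.length with h0 | h0
      · obtain rfl := List.length_eq_zero_iff.1 h0
        rw [List.append_nil]
        exact skip su sc hu' hc
      · obtain ⟨t, ⟨v, hv, hvt⟩, f, h1, h2, rfl, rfl⟩ := ih hu' hc (s' + r.length)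
        obtain ⟨g, g1, g2, g3, g4, g5⟩ := glue (.plain r.length) t r f rfl hr h1 h2
        refine ⟨.plain r.length :: t, ⟨.plain k :: v, hv.cons_cons _, .cons (.plain _ _ h0 ?_) hvt⟩,
          g, g1, g2, ?_, g4.symm⟩
        · simpa using hr.length_le
        · simp only [Part.size] at g3 g5
          simp [uncircledWord, g3, g5]

/-! ### Containment and domination -/

theorem exists_isRotated_sublist {l l' s : List ℕ} (h : l ~r l') (hs : s.Sublist l) :
    ∃ s', s' ~r s ∧ s'.Sublist l' := by
  obtain ⟨k, rfl⟩ := h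
  induction k generalizing l s with
  | zero => exact ⟨s, .refl _, by simpa using hs⟩
  | succ k ih =>
    rcases l with _ | ⟨a, l⟩
    · exact ⟨s, .refl _, by simpa using hs⟩
    · rw [List.rotate_cons_succ]
      rcases List.sublist_cons_iff.1 hs with hs' | ⟨r, rfl, hs'⟩
      · exact ih (hs'.trans (List.sublist_append_left _ _))
      · obtain ⟨s', h1, h2⟩ := ih (hs'.append (List.Sublist.refl [a]))
        exact ⟨s', h1.trans (List.isRotated_append (l := r) (l' := [a])), h2⟩

/-- An occurrence of the pattern can be rotated into a subsequence of `word X.parts`, hence comes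
from some embedded `t`. Then `word t` and a rotation of `π` are order isomorphic permutations of
initial segments, so they coincide. -/
theorem circularContains_iff {N m : ℕ} (X : CircledComposition N) {π : List ℕ}
    (hπ : π.Perm (List.range' 1 m)) :
    CircularContains X.toCircularPerm π ↔ ∃ t, Embeds t X.parts ∧ word t ~r π := by
  constructor
  · rintro ⟨l, p, hl, hp, s, hs, hsp⟩
    have hl : l ~r word X.parts := Cycle.coe_eq_coe.1 hl
    have hp : p ~r π := Cycle.coe_eq_coe.1 hp
    obtain ⟨s', hs', hsub⟩ := exists_isRotated_sublist hl hs
    have hpp : p.Perm (List.range' 1 m) := hp.perm.trans hπ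
    have hnd := List.nodup_range' (s := 1) (n := m) (step := 1)
    obtain ⟨f, hf, rfl⟩ := hsp.exists_map (hpp.nodup_iff.2 hnd)
    obtain ⟨k, hk⟩ := hs'.symm
    rw [← List.map_rotate] at hk
    subst hk
    have hiso : OrderIsomorphic ((p.rotate k).map f) (p.rotate k) :=
      orderIsomorphic_map (by simpa using hf)
    obtain ⟨su, sc, hsplit, hsu, hsc⟩ := List.sublist_append_iff.1 hsub
    obtain ⟨t, ht, g, hg, -, rfl, rfl⟩ := exists_embeds_of_sublist hsu hsc 1
    rw [← List.map_append] at hsplit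
    have hg' : OrderIsomorphic ((word t).map g) (word t) :=
      orderIsomorphic_map (hg.mono fun x hx => by
        have := mem_word.1 (List.mem_append.1 hx)
        simpa using this)
    rw [hsplit] at hiso
    have heq := eq_of_orderIsomorphic (word_perm t 1) ((List.rotate_perm p k).trans hpp)
      (hg'.symm.trans hiso)
    refine ⟨t, ht, ?_⟩
    change word t = _ at heq
    rw [heq]
    exact (List.IsRotated.symm ⟨k, rfl⟩).trans hp
  · rintro ⟨t, ht, h⟩
    obtain ⟨f, hf, -, h1, h2⟩ := exists_sublist_of_embeds ht 1 1
    refine ⟨word X.parts, word t, rfl, Cycle.coe_eq_coe.2 h, (word t).map f, ?_, ?_⟩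
    · rw [word, List.map_append]
      exact h1.append h2
    · exact orderIsomorphic_map (hf.mono fun x hx => by
        have := mem_word.1 (List.mem_append.1 hx)
        simpa using this)

theorem Embeds.positive {t w : List Part} (h : Embeds t w) : Positive t := by
  obtain ⟨s, -, h⟩ := h
  induction h with
  | nil => exact positive_nil
  | cons hpq _ ih => exact positive_cons.2 ⟨by cases hpq <;> simp [Part.size, *], ih⟩

theorem dominates_iff {N n : ℕ} (X : CircledComposition N) (Y : CircledComposition n) :
    Dominates X Y ↔ ∃ t, Embeds t X.parts ∧ Y.parts = circleLast (circleFirst t) := by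
  constructor
  · rintro ⟨s, t, h1, h2, h3⟩
    exact ⟨t, ⟨s, h1, h2⟩, h3⟩
  · rintro ⟨t, ⟨s, h1, h2⟩, h3⟩
    exact ⟨s, t, h1, h2, h3⟩

theorem CircledComposition.word_perm {n : ℕ} (X : CircledComposition n) :
    (word X.parts).Perm (List.range' 1 n) := by
  have := CircularPattern.word_perm X.parts 1
  rwa [show totalSize X.parts = n from X.sum_size] at this

/-- Circling the ends of `t` changes its word only by a rotation, and the circular permutation
determines the circled composition. -/
theorem circularContains_iff_dominates {N n : ℕ} (X : CircledComposition N)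
    (Y : CircledComposition n) :
    CircularContains X.toCircularPerm Y.toCircularPerm ↔ Dominates X Y := by
  rw [dominates_iff]
  refine (circularContains_iff X Y.word_perm).trans (exists_congr fun t => and_congr_right
    fun ht => ⟨fun h => ?_, fun h => ?_⟩)
  · have hne : t ≠ [] := by
      rintro rfl
      have h1 := h.perm.length_eq
      rw [length_word, length_word] at h1
      have h2 := length_le_totalSize Y.isCircled.pos
      have h3 := Y.isCircled.head
      rw [← h1] at h2
      simp at h2
      simp [h2] at h3
    exact Y.isCircled.eq_of_word_isRotated (isCircled_circleLast_circleFirst hne ht.positive)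
      (h.symm.trans (word_circleLast_circleFirst t).symm)
  · rw [h]
    exact (word_circleLast_circleFirst t).symm

/-- Otherwise `[1324]` would itself come from a circled composition of `4`. Read from `1`, its
circled numbers form an increasing prefix of `1324` that contains `4`, which is impossible because
`3` precedes `2`. -/
theorem not_circularContains_c1324 {N : ℕ} (X : CircledComposition N) :
    ¬ CircularContains X.toCircularPerm c1324 := by
  intro h
  obtain ⟨t, ht, h⟩ := (circularContains_iff (m := 4) X (π := [1, 3, 2, 4]) (by decide)).1 h
  have hne : t ≠ [] := by
    rintro rfl
    have := h.perm.length_eq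
    simp [length_word] at this
  have hy := isCircled_circleLast_circleFirst hne ht.positive
  have h1 := (word_circleLast_circleFirst t).trans h
  set y := circleLast (circleFirst t)
  have h4 : totalSize y = 4 := by rw [← length_word, h1.perm.length_eq]; rfl
  have hmem := hy.totalSize_mem
  rw [h4] at hmem
  obtain ⟨c, hc⟩ := hy.exists_circledWord_eq
  have h2 := (word_isRotated y).symm.trans h1
  have hnd := (word_isRotated y).perm.nodup_iff.1 (nodup_word y)
  rw [hc] at h2 hnd
  have h3 := eq_of_cons_isRotated_cons hnd h2
  have hp := circledWord_pairwise y 1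
  rw [hc] at hmem hp
  have hpre : c <+: [3, 2, 4] := ⟨_, h3⟩
  have hlen := hpre.length_le
  rw [List.prefix_iff_eq_take] at hpre
  simp only [List.length_cons, List.length_nil] at hlen
  generalize c.length = k at hpre hlen
  subst hpre
  interval_cases k <;> simp at hmem hp

/-! ### Circular permutations that avoid `[1324]` -/

theorem cons_eq_range' {U : List ℕ} {s : ℕ} (h : (s :: U).Pairwise (· < ·))
    (hU : ∀ v, ∀ r ∈ U, s < v → v < r → v ∈ U) : s :: U = List.range' s (U.length + 1) := by
  induction U generalizing s with
  | nil => rfl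
  | cons y U ih =>
    have h1 := List.pairwise_cons.1 h
    have h2 := List.pairwise_cons.1 h1.2
    have hsy := h1.1 y (by simp)
    obtain rfl : y = s + 1 := by
      by_contra hne
      have := hU (s + 1) y (by simp) (by omega) (by omega)
      rcases List.mem_cons.1 this with h | h
      · omega
      · have := h2.1 _ h
        omega
    rw [List.length_cons, List.range'_succ, ← ih h1.2]
    intro v r hr hv hvr
    rcases List.mem_cons.1 (hU v r (by simp [hr]) (by omega) hvr) with h | h
    · omega
    · exact h

/-- The parts are peeled off at the smallest number `s`. If `s` is in `C`, the first part is
circled; if `s` is in `U`, the stretch of `U` from `s` to its end turns out to be an interval, which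
is the first part. -/
theorem exists_parts_of_words (m : ℕ) (s : ℕ) (U C : List ℕ)
    (hperm : (U ++ C).Perm (List.range' s m)) (hC : C.Pairwise (· < ·))
    (h213 : ∀ a b c, [b, a, c].Sublist U → a < b → ¬ b < c)
    (h132 : ∀ a b c, [a, c, b].Sublist U → a < b → ¬ b < c)
    (hstr : ∀ a b c, [a, b].Sublist U → c ∈ C → a < c → ¬ c < b) :
    ∃ y, Positive y ∧ U = uncircledWord y s ∧ C = circledWord y s := by
  induction m using Nat.strong_induction_on generalizing s U C with
  | _ m ih =>
  have hmem : ∀ x, x ∈ U ∨ x ∈ C ↔ s ≤ x ∧ x < s + m := by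
    intro x
    rw [← List.mem_append, hperm.mem_iff, List.mem_range'_1]
  have hnd : (U ++ C).Nodup := hperm.nodup_iff.2 (List.nodup_range' (step := 1))
  rcases m with _ | m
  · have := hperm.length_eq
    simp at this
    exact ⟨[], positive_nil, by simp [uncircledWord, this], by simp [circledWord, this]⟩
  rcases (hmem s).2 ⟨le_rfl, by omega⟩ with hs | hs
  · obtain ⟨U₁, U₂, rfl⟩ := List.append_of_mem hs
    -- With `s` in the middle as the smallest entry, the opposite would be a `213`.
    have hgt : ∀ x ∈ U₁, ∀ y ∈ U₂, y < x := by
      intro x hx y hy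
      by_contra hlt
      have hne : x ≠ y ∧ x ≠ s := by
        simp only [List.nodup_append, List.nodup_cons] at hnd
        exact ⟨hnd.1.2.2 x hx y (by simp [hy]), hnd.1.2.2 x hx s (by simp)⟩
      have hsub : [x, s, y].Sublist (U₁ ++ s :: U₂) :=
        (List.singleton_sublist.2 hx).append ((List.singleton_sublist.2 hy).cons_cons s)
      have := (hmem x).1 (by simp [hx])
      exact h213 s x y hsub (by omega) (by omega)
    have hlt : ∀ x ∈ U₂, s < x := by
      intro x hx
      have h1 := (hmem x).1 (by simp [hx])
      have : s ≠ x := by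
        rintro rfl
        simp [List.nodup_append, hx] at hnd
      omega
    have hsorted : (s :: U₂).Pairwise (· < ·) := by
      refine List.pairwise_cons.2 ⟨hlt, ?_⟩
      rw [List.pairwise_iff_forall_sublist]
      intro x y hxy
      by_contra hle
      have hnd2 : [x, y].Nodup := by
        have : U₂.Nodup := by
          simp only [List.nodup_append, List.nodup_cons] at hnd
          exact hnd.1.2.1.2
        exact this.sublist hxy
      have hne : x ≠ y := by simpa using hnd2
      have := hlt y (hxy.subset (by simp))
      exact h132 s y x ((hxy.cons_cons s).trans (List.sublist_append_right _ _)) this (by omega)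
    -- A gap in `s :: U₂` can be filled neither from `U₁`, whose entries are too large, nor from
    -- `C`, because of `hstr`.
    have hrange : s :: U₂ = List.range' s (U₂.length + 1) := by
      refine cons_eq_range' hsorted fun v r hr hv hvr => ?_
      have h1 := (hmem r).1 (by simp [hr])
      rcases (hmem v).2 ⟨by omega, by omega⟩ with h | h
      · rcases List.mem_append.1 h with h | h
        · have := hgt v h r hr
          omega
        · rcases List.mem_cons.1 h with h | h
          · omega
          · exact h
      · have hsub : [s, r].Sublist (U₁ ++ s :: U₂) :=
          ((List.singleton_sublist.2 hr).cons_cons s).trans (List.sublist_append_right _ _)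
        exact absurd hvr (hstr s r v hsub h hv)
    have hlen := hperm.length_eq
    simp only [List.length_append, List.length_cons, List.length_range'] at hlen
    set k := U₂.length + 1 with hk
    have hperm' : (U₁ ++ C).Perm (List.range' (s + k) (m + 1 - k)) := by
      rw [hrange, List.append_assoc] at hperm
      have h1 : List.range' s (m + 1) = List.range' s k ++ List.range' (s + k) (m + 1 - k) := by
        have := List.range'_append (s := s) (m := k) (n := m + 1 - k) (step := 1)
        rw [one_mul] at this
        rw [this]
        congr 1
        omega
      rw [h1] at hperm
      exact (List.perm_append_left_iff _).1 ((List.perm_append_comm_assoc _ _ _).trans hperm)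
    have hU₁ : U₁.Sublist (U₁ ++ s :: U₂) := List.sublist_append_left _ _
    obtain ⟨y, hy, h1, h2⟩ := ih (m + 1 - k) (by omega) (s + k) U₁ C hperm' hC
      (fun a b c h => h213 a b c (h.trans hU₁)) (fun a b c h => h132 a b c (h.trans hU₁))
      (fun a b c h => hstr a b c (h.trans hU₁))
    refine ⟨.plain k :: y, positive_cons.2 ⟨by simp [Part.size, hk], hy⟩, ?_, h2⟩
    rw [uncircledWord, ← h1, hrange]
  · rcases C with _ | ⟨c, C⟩
    · simp at hs
    obtain rfl : c = s := by
      rcases List.mem_cons.1 hs with h | h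
      · exact h.symm
      · have h1 := (List.pairwise_cons.1 hC).1 s h
        have h2 := (hmem c).1 (by simp)
        omega
    have hperm' : (U ++ C).Perm (List.range' (c + 1) m) := by
      rw [List.range'_succ] at hperm
      exact (List.perm_middle.symm.trans hperm).cons_inv
    obtain ⟨y, hy, h1, h2⟩ := ih m (by omega) (c + 1) U C hperm' (List.pairwise_cons.1 hC).2
      h213 h132 (fun a b x h hx => hstr a b x h (by simp [hx]))
    exact ⟨.circ :: y, positive_cons.2 ⟨by simp [Part.size], hy⟩, h1, by rw [circledWord, ← h2]⟩

theorem isCircled_of_mem {y : List Part} (hp : Positive y) (h1 : 1 ∈ circledWord y 1)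
    (h2 : totalSize y ∈ circledWord y 1) : IsCircled y := by
  refine ⟨hp, ?_, ?_⟩
  · rcases y with _ | ⟨_ | k, l⟩
    · simp [circledWord] at h1
    · rfl
    · have := ((mem_word (l := l) (s := 1 + k)).1 (.inr h1)).1
      have := hp k (by simp)
      omega
  · rcases List.eq_nil_or_concat y with rfl | ⟨l, p, rfl⟩
    · simp [circledWord] at h1
    · rw [List.concat_eq_append] at *
      cases p with
      | circ => simp
      | plain k =>
        simp only [circledWord_append, circledWord, List.append_nil, totalSize_append,
          totalSize_cons, Part.size, totalSize_nil] at h2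
        have := (mem_word.1 (.inr h2)).2
        have := hp k (by simp)
        omega

/-- Read the cycle from `1`: the entries up to `N` become the circled numbers, the others the
uncircled ones. Each hypothesis of `exists_parts_of_words` holds because a violation, together with
`1` or `N` or both, forms a rotation of `1324`. -/
theorem exists_toCircularPerm_eq {N : ℕ} (hN : 1 ≤ N) {σ : Cycle ℕ}
    (hσ : σ ∈ avoiders N {c1324}) : ∃ X : CircledComposition N, X.toCircularPerm = σ := by
  obtain ⟨⟨l, hl, rfl⟩, hav⟩ := hσ
  have hav := hav _ rfl
  obtain ⟨C, U, hrot, hC, hN_mem, hlast⟩ : ∃ C U, l ~r (1 :: (C ++ U)) ∧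
      (1 :: C ++ U).Perm (List.range' 1 N) ∧ N ∈ 1 :: C ∧
      (C = [] ∨ ∃ c, C = c ++ [N]) := by
    have h1 : 1 ∈ l := by rw [hl.mem_iff, List.mem_range'_1]; omega
    have h2 : N ∈ l := by rw [hl.mem_iff, List.mem_range'_1]; omega
    obtain ⟨a, b, rfl⟩ := List.append_of_mem h1
    have hr : (a ++ 1 :: b) ~r (1 :: (b ++ a)) := List.isRotated_append
    have h3 : N ∈ 1 :: (b ++ a) := hr.perm.mem_iff.1 h2
    have hp := hr.perm.symm.trans hl
    rcases List.mem_cons.1 h3 with rfl | h3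
    · exact ⟨[], b ++ a, hr, hp, by simp, by simp⟩
    · obtain ⟨c, U, hcU⟩ := List.append_of_mem h3
      rw [hcU] at hr hp
      exact ⟨c ++ [N], U, by simpa using hr, by simpa using hp, by simp, .inr ⟨c, rfl⟩⟩
  have hav' : ∀ s l' p : List ℕ, l' ~r (1 :: C ++ U) → s.Sublist l' → p ~r [1, 3, 2, 4] →
      ¬ OrderIsomorphic s p := by
    intro s l' p h1 h2 h3 h4
    exact hav ⟨l', p, Cycle.coe_eq_coe.2 (h1.trans hrot.symm), Cycle.coe_eq_coe.2 h3, s, h2, h4⟩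
  have hnd : (1 :: C ++ U).Nodup := hC.nodup_iff.2 (List.nodup_range' (step := 1))
  have hmem : ∀ x, x ∈ 1 :: C ∨ x ∈ U ↔ 1 ≤ x ∧ x ≤ N := by
    intro x
    rw [← List.mem_append, hC.mem_iff, List.mem_range'_1]
    omega
  have hndC : (1 :: C).Nodup := hnd.sublist (List.sublist_append_left _ _)
  have hdisj : ∀ x ∈ U, x ≠ 1 ∧ x ≠ N := by
    intro x hx
    have := (List.nodup_append.1 hnd).2.2
    exact ⟨(this 1 (by simp) x hx).symm, (this N hN_mem x hx).symm⟩
  have hbd : ∀ x ∈ U, 1 < x ∧ x < N := by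
    intro x hx
    have h1 := (hmem x).1 (.inr hx)
    have h2 := hdisj x hx
    omega
  have hrot' : (U ++ 1 :: C) ~r (1 :: C ++ U) := List.isRotated_append
  have hsorted : (1 :: C).Pairwise (· < ·) := by
    rw [List.pairwise_cons]
    constructor
    · intro x hx
      have h3 := (hmem x).1 (.inl (by simp [hx]))
      have : x ≠ 1 := by
        rintro rfl
        simp [hx] at hndC
      omega
    · rcases hlast with rfl | ⟨c, rfl⟩
      · simp
      have hcN : ∀ x ∈ c, x < N := by
        intro x hx
        have h3 := (hmem x).1 (.inl (by simp [hx]))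
        have : x ≠ N := by
          rintro rfl
          simp only [List.nodup_cons, List.nodup_append] at hndC
          exact hndC.2.2.2 x hx x (by simp) rfl
        omega
      refine List.pairwise_append.2 ⟨?_, by simp, by simpa using hcN⟩
      rw [List.pairwise_iff_forall_sublist]
      intro b a hab
      by_contra hle
      have hba : b ≠ a := by
        have : [b, a].Nodup :=
          hndC.sublist ((hab.trans (List.sublist_append_left _ _)).trans (List.sublist_cons_self _ _))
        simpa using this
      have ha : a ∈ c := hab.subset (by simp)
      have h3 := (hmem a).1 (.inl (by simp [ha]))
      have h4 : a ≠ 1 := by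
        rintro rfl
        simp [ha] at hndC
      have h5 := hcN b (hab.subset (by simp))
      refine hav' [1, b, a, N] _ [1, 3, 2, 4] (.refl _) (List.Sublist.trans
        ((hab.append (List.Sublist.refl [N])).cons_cons 1) (List.sublist_append_left _ _))
        (.refl _) ⟨rfl, ?_⟩
      intro i j
      fin_cases i <;> fin_cases j <;> simp <;> omega
  have h213 : ∀ a b c, [b, a, c].Sublist U → a < b → ¬ b < c := by
    intro a b c hs hab hbc
    have := hbd a (hs.subset (by simp))
    refine hav' [b, a, c, 1] _ [3, 2, 4, 1] hrot' (hs.append (by simp)) ⟨3, by simp⟩ ⟨rfl, ?_⟩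
    intro i j
    fin_cases i <;> fin_cases j <;> simp <;> omega
  have h132 : ∀ a b c, [a, c, b].Sublist U → a < b → ¬ b < c := by
    intro a b c hs hab hbc
    have h3 := hbd c (hs.subset (by simp))
    refine hav' [N, a, c, b] _ [4, 1, 3, 2] (.refl _)
      ((List.singleton_sublist.2 hN_mem).append hs) ⟨1, by simp⟩ ⟨rfl, ?_⟩
    intro i j
    fin_cases i <;> fin_cases j <;> simp <;> omega
  have hstr : ∀ a b c, [a, b].Sublist U → c ∈ 1 :: C → a < c → ¬ c < b := by
    intro a b c hs hc hac hcb
    have h3 := hbd b (hs.subset (by simp))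
    have h4 := hbd a (hs.subset (by simp))
    have hcC : c ∈ C := by
      rcases List.mem_cons.1 hc with rfl | h
      · omega
      · exact h
    have hcN : [c, N].Sublist (1 :: C) := by
      rcases hlast with rfl | ⟨d, rfl⟩
      · simp at hcC
      · have hcd : c ∈ d := by simpa [show c ≠ N by omega] using hcC
        exact ((List.singleton_sublist.2 hcd).append (List.Sublist.refl [N])).trans
          (List.sublist_cons_self _ _)
    -- A circled `c` between `a` and `b` in value precedes `N`, and both precede the uncircled `a,
    -- b`.
    refine hav' [c, N, a, b] _ [2, 4, 1, 3] (.refl _) (hcN.append hs) ⟨2, by simp⟩ ⟨rfl, ?_⟩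
    intro i j
    fin_cases i <;> fin_cases j <;> simp <;> omega
  obtain ⟨y, hy, h1, h2⟩ := exists_parts_of_words N 1 U (1 :: C)
    (List.perm_append_comm.trans hC) hsorted h213 h132 hstr
  have hsum : totalSize y = N := by
    have h3 := length_word y
    have h4 := hC.length_eq
    rw [word, ← h1, ← h2] at h3
    simp at h3 h4
    omega
  have hcirc := isCircled_of_mem hy (by rw [← h2]; simp) (by rw [← h2, hsum]; exact hN_mem)
  refine ⟨⟨y, hcirc.pos, hsum, hcirc.head, hcirc.last⟩, Cycle.coe_eq_coe.2 ?_⟩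
  change (uncircledWord y 1 ++ circledWord y 1) ~r _
  rw [← h1, ← h2]
  exact hrot'.trans hrot.symm

/-! ### Wilf equivalence of pairs of patterns -/

theorem CircledComposition.ext_parts {n : ℕ} {X Y : CircledComposition n}
    (h : X.parts = Y.parts) : X = Y := by
  cases X
  cases Y
  congr

theorem toCircularPerm_injective (n : ℕ) :
    Function.Injective (CircledComposition.toCircularPerm (n := n)) := fun X Y h =>
  CircledComposition.ext_parts
    (X.isCircled.eq_of_word_isRotated Y.isCircled (Cycle.coe_eq_coe.1 h))

theorem toCircularPerm_mem_avoiders {n : ℕ} (X : CircledComposition n) :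
    X.toCircularPerm ∈ avoiders n {c1324} := by
  refine ⟨⟨_, X.word_perm, rfl⟩, ?_⟩
  rintro _ rfl
  exact not_circularContains_c1324 X

instance (n : ℕ) : Finite (CircledComposition n) := by
  have := (words_finite Set.univ n).to_subtype
  exact Finite.of_injective
    (fun X : CircledComposition n =>
      (⟨X.parts, Set.mem_univ _, X.plain_pos, X.sum_size⟩ : words Set.univ n))
    fun X Y h => CircledComposition.ext_parts (congrArg Subtype.val h)

/-- Under the bijection with circled compositions of `N`, avoiding the second pattern means not
dominating `X`. -/
theorem ncard_avoiders {n N : ℕ} (hN : 1 ≤ N) (X : CircledComposition n) :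
    (avoiders N {c1324, X.toCircularPerm}).ncard +
      Nat.card {Z : CircledComposition N // Dominates Z X} = Nat.card (CircledComposition N) := by
  have : avoiders N {c1324, X.toCircularPerm} =
      CircledComposition.toCircularPerm '' {Z : CircledComposition N | Dominates Z X}ᶜ := by
    ext σ
    constructor
    · rintro ⟨h1, h2⟩
      obtain ⟨Z, rfl⟩ := exists_toCircularPerm_eq hN (σ := σ) ⟨h1, fun d hd => h2 d (.inl hd)⟩
      exact ⟨Z, fun h => h2 _ (.inr rfl) ((circularContains_iff_dominates Z X).2 h), rfl⟩
    · rintro ⟨Z, hZ, rfl⟩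
      have := toCircularPerm_mem_avoiders Z
      refine ⟨this.1, ?_⟩
      rintro _ (rfl | rfl)
      · exact this.2 _ rfl
      · exact fun h => hZ ((circularContains_iff_dominates Z X).1 h)
  rw [this, Set.ncard_image_of_injective _ (toCircularPerm_injective N), add_comm]
  exact Set.ncard_add_ncard_compl {Z : CircledComposition N | Dominates Z X}

theorem WilfEquiv.patternWilfEquiv {m n : ℕ} {X : CircledComposition m} {Y : CircledComposition n}
    (h : WilfEquiv X Y) :
    PatternWilfEquiv {c1324, X.toCircularPerm} {c1324, Y.toCircularPerm} := by
  intro N hN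
  have h1 := ncard_avoiders hN X
  have h2 := ncard_avoiders hN Y
  have h3 := h N hN
  omega

end CircularPattern

theorem mainTheorem6 (n : ℕ) (hn : 1 ≤ n) :
    (∀ X : CircularPattern.CircledComposition n,
      ∃ Y : CircularPattern.CircledComposition n,
        Y.IsNormalForm ∧ CircularPattern.WilfEquiv X Y) ∧
    (∀ σ ∈ CircularPattern.avoiders n {CircularPattern.c1324},
      ∃ Y : CircularPattern.CircledComposition n,
        Y.IsNormalForm ∧
        Y.toCircularPerm ∈ CircularPattern.avoiders n {CircularPattern.c1324} ∧
        CircularPattern.PatternWilfEquiv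
          {CircularPattern.c1324, σ} {CircularPattern.c1324, Y.toCircularPerm}) := by
  refine ⟨fun X => CircularPattern.exists_normalForm_wilfEquiv X, fun σ hσ => ?_⟩
  obtain ⟨X, rfl⟩ := CircularPattern.exists_toCircularPerm_eq hn hσ
  obtain ⟨Y, hY, h⟩ := CircularPattern.exists_normalForm_wilfEquiv X
  exact ⟨Y, hY, CircularPattern.toCircularPerm_mem_avoiders Y, h.patternWilfEquiv⟩
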